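/- **Theorem 1.3.** Let $\Bbbk$ be a field of characteristic $0$. A cdga is a commutative differential graded algebra $A=\bigoplus_{i\ge 0}A^i$ over $\Bbbk$; it is *$1$-finite* if $A^0=\Bbbk\cdot 1$ (with $1\neq 0$) and $\dim_\Bbbk A^1<\infty$. For a $1$-finite cdga $A$, put $A_i=\operatorname{Hom}(A^i,\Bbbk)$, let $\mathbb{L}(A_1)$ be the free Lie algebra on $A_1$ (with $\mathbb{L}_2(A_1)=A_1\wedge A_1$), and let $d^*\colon A_2\to A_1$ and $\mu^*\colon A_2\to A_1\wedge A_1$ be the duals of the differential $A^1\to A^2$ and of the multiplication $A^1\wedge A^1\to A^2$. The *holonomy Lie algebra* of $A$ is $\mathfrak h(A)=\mathbb{L}(A_1)/(\operatorname{im}(d^*+\mu^*))$. For a finitely generated Lie algebra $\mathfrak h$ with lower central series $\Gamma_1=\mathfrak h$, $\Gamma_{n+1}=[\mathfrak h,\Gamma_n]$, put $\widehat{\mathcal C}(\mathfrak h)=\varinjlim_n \mathcal C(\mathfrak h/\Gamma_n)$, where $\mathcal C(\mathfrak g)=(\bigwedge\mathfrak g^*,d)$ is the Chevalley–Eilenberg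 cochain cdga of a finite-dimensional Lie algebra $\mathfrak g$, whose differential on the generators is minus the dual of the Lie bracket. Let $\omega=\sum_i x_i^*\otimes x_i\in A^1\otimes\mathfrak h(A)$ be the canonical flat connection, where $\{x_i\}$ is a basis of $A_1$ and $\{x_i^*\}$ is the dual basis of $A^1$. It satisfies the Maurer–Cartan equation $d\omega+\frac12[\omega,\omega]=0$, and so do its images $\omega_n\in A^1\otimes\mathfrak h(A)/\Gamma_n$. Let $f_n\colon\mathcal C(\mathfrak h(A)/\Gamma_n)\to A$ be the cdga map whose restriction $(\mathfrak h(A)/\Gamma_n)^*\to A^1$ to the generators corresponds to $\omega_n$ under $A^1\otimes\mathfrak g\cong\operatorname{Hom}(\mathfrak g^*,A^1)$. The maps $f_n$ are compatible; let $f_A\colon\widehat{\mathcal C}(\mathfrak h(A))\to A$ be their limit, the *classifying map* of $A$. Then $f_A$ is a functorial $1$-minimal model map for $A$. That is: 1. for every $1$-finite cdga $A$, the cdga $\widehat{\mathcal C}(\mathfrak h(A))$ is $1$-minimal (it is of the form $(\bigwedge V,d)$ with $V$ concentrated in degree $1$, where $V$ has an exhaustive increasing filtration $0=V^1\subseteq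 V^2\subseteq\cdots$ with $d(V^{n+1})\subseteq\bigwedge V^n$ for all $n$, so that it is a union of successive Hirsch extensions), and $f_A$ is a $1$-equivalence: $H^0(f_A)$ and $H^1(f_A)$ are isomorphisms and $H^2(f_A)$ is injective; 2. $A\mapsto\widehat{\mathcal C}(\mathfrak h(A))$ is a functor on $1$-finite cdgas, where a cdga map $\varphi\colon A\to B$ induces the Lie algebra map $\mathfrak h(B)\to\mathfrak h(A)$ which extends the dual map $B_1\to A_1$, and hence a cdga map $\varphi_*\colon\widehat{\mathcal C}(\mathfrak h(A))\to\widehat{\mathcal C}(\mathfrak h(B))$; and $f_A$ is natural in $A$: $\varphi\circ f_A=f_B\circ\varphi_*$ for every cdga map $\varphi\colon A\to B$ of $1$-finite cdgas. -/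

import Mathlib

open scoped TensorProduct DirectSum

universe u v w v₁ v₂ v₃

noncomputable section

/-- A commutative differential graded algebra `A = ⨁_{i ≥ 0} Aⁱ` over the field `k`: the underlying
algebra is `carrier`, with its decomposition into the subspaces `deg i`. -/
structure CDGA (k : Type u) [Field k] where
  carrier : Type v
  [ring : Ring carrier]
  [algebra : Algebra k carrier]
  deg : ℕ → Submodule k carrier
  [graded : GradedAlgebra deg]
  d : carrier →ₗ[k] carrier
  d_mem : ∀ {i : ℕ} {a : carrier}, a ∈ deg i → d a ∈ deg (i + 1)
  d_d : ∀ a : carrier, d (d a) = 0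
  leibniz : ∀ {i : ℕ} {a : carrier}, a ∈ deg i → ∀ b : carrier,
    d (a * b) = d a * b + (-1) ^ i * (a * d b)
  mul_comm : ∀ {i j : ℕ} {a b : carrier}, a ∈ deg i → b ∈ deg j →
    a * b = (-1) ^ (i * j) * (b * a)

namespace CDGA

attribute [instance] CDGA.ring CDGA.algebra CDGA.graded

variable {k : Type u} [Field k]

/-- A cdga map: a map of algebras, of degree zero, which commutes with the differentials. -/
@[ext]
structure Hom (A : CDGA.{u, v₁} k) (B : CDGA.{u, v₂} k) where
  toAlgHom : A.carrier →ₐ[k] B.carrier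
  map_deg : ∀ {i : ℕ} {a : A.carrier}, a ∈ A.deg i → toAlgHom a ∈ B.deg i
  map_d : ∀ a : A.carrier, toAlgHom (A.d a) = B.d (toAlgHom a)

/-- The identity map. -/
def Hom.id (A : CDGA.{u, v} k) : Hom A A where
  toAlgHom := AlgHom.id k A.carrier
  map_deg h := h
  map_d _ := rfl

/-- The composition `g ∘ f`. -/
def Hom.comp {A : CDGA.{u, v₁} k} {B : CDGA.{u, v₂} k} {C : CDGA.{u, v₃} k}
    (g : Hom B C) (f : Hom A B) : Hom A C where
  toAlgHom := g.toAlgHom.comp f.toAlgHom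
  map_deg h := g.map_deg (f.map_deg h)
  map_d a := by simp [f.map_d, g.map_d]

/-- `A` is `q`-finite: it is connected, that is, `A⁰ = k · 1` (with `1 ≠ 0`), and
`∑_{i ≤ q} dim Aⁱ < ∞`. -/
class IsFinite (q : ℕ) (A : CDGA.{u, v} k) : Prop where
  one_ne_zero : (1 : A.carrier) ≠ 0
  deg_zero : A.deg 0 = Submodule.span k {1}
  finite_deg : ∀ i ≤ q, FiniteDimensional k (A.deg i)

/-! ### Cohomology and `q`-equivalences -/

/-- The cocycles `Zⁱ(A) = ker (d : Aⁱ → Aⁱ⁺¹)`. -/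
def cocycles (A : CDGA.{u, v} k) (i : ℕ) : Submodule k A.carrier :=
  A.deg i ⊓ LinearMap.ker A.d

/-- The coboundaries `Bⁱ(A) = im (d : Aⁱ⁻¹ → Aⁱ)`. -/
def coboundaries (A : CDGA.{u, v} k) : ℕ → Submodule k A.carrier
  | 0 => ⊥
  | i + 1 => (A.deg i).map A.d

/-- The cohomology `Hⁱ(A) = Zⁱ(A) / Bⁱ(A)`. -/
abbrev Cohomology (A : CDGA.{u, v} k) (i : ℕ) : Type v :=
  A.cocycles i ⧸ (A.coboundaries i).submoduleOf (A.cocycles i)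

variable {A : CDGA.{u, v₁} k} {B : CDGA.{u, v₂} k}

theorem Hom.map_mem_cocycles (f : Hom A B) (i : ℕ) {a : A.carrier} (ha : a ∈ A.cocycles i) :
    f.toAlgHom a ∈ B.cocycles i := by
  refine ⟨f.map_deg ha.1, ?_⟩
  have h : A.d a = 0 := ha.2
  change B.d (f.toAlgHom a) = 0
  rw [← f.map_d, h, map_zero]

theorem Hom.map_mem_coboundaries (f : Hom A B) (i : ℕ) {a : A.carrier}
    (ha : a ∈ A.coboundaries i) : f.toAlgHom a ∈ B.coboundaries i := by
  cases i with
  | zero =>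
    have h : a = 0 := ha
    rw [h, map_zero]
    exact Submodule.zero_mem _
  | succ i =>
    obtain ⟨b, hb, rfl⟩ := ha
    exact ⟨f.toAlgHom b, f.map_deg hb, (f.map_d b).symm⟩

/-- The map `Zⁱ(A) → Zⁱ(B)` induced by a cdga map. -/
def Hom.mapCocycles (f : Hom A B) (i : ℕ) : A.cocycles i →ₗ[k] B.cocycles i :=
  f.toAlgHom.toLinearMap.restrict fun _ ha => f.map_mem_cocycles i ha

/-- The map `Hⁱ(f) : Hⁱ(A) → Hⁱ(B)` induced by a cdga map `f`. -/
def Hom.mapCohomology (f : Hom A B) (i : ℕ) : A.Cohomology i →ₗ[k] B.Cohomology i :=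
  Submodule.mapQ _ _ (f.mapCocycles i) fun _ ha => f.map_mem_coboundaries i ha

/-- `f` is a `q`-equivalence: it induces isomorphisms in cohomology up to degree `q` and a
monomorphism in degree `q + 1`. -/
def Hom.IsEquivalence (q : ℕ) (f : Hom A B) : Prop :=
  (∀ i ≤ q, Function.Bijective (f.mapCohomology i)) ∧ Function.Injective (f.mapCohomology (q + 1))

/-! ### `1`-minimal cdgas -/

/-- `M` is freely generated, as a graded-commutative algebra, by the subspace `V` of `M¹`: the
inclusion of `V` extends to an isomorphism of algebras `⋀ V ≅ M`. -/
def IsFreeOn (M : CDGA.{u, v} k) (V : Submodule k M.carrier) : Prop :=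
  V ≤ M.deg 1 ∧ ∃ e : ExteriorAlgebra k V ≃ₐ[k] M.carrier, ∀ x : V, e (ExteriorAlgebra.ι k x) = x

/-- `M` is `1`-minimal: `M = (⋀ V, d)` for a space `V` of generators of degree one which has an
exhaustive increasing filtration `0 = F 0 ⊆ F 1 ⊆ ⋯` such that each
`⋀ (F n) ⊆ ⋀ (F (n + 1))` is a Hirsch extension, that is, `⋀ (F (n + 1))` is obtained from the
sub-cdga `⋀ (F n)` by adjoining free generators (of degree one) whose differentials lie in
`⋀ (F n)`. -/
def IsOneMinimal (M : CDGA.{u, v} k) : Prop :=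
  ∃ F : ℕ → Submodule k M.carrier, F 0 = ⊥ ∧ Monotone F ∧ M.IsFreeOn (⨆ n, F n) ∧
    ∀ n, ∀ x ∈ F (n + 1), M.d x ∈ Algebra.adjoin k (F n : Set M.carrier)

/-- A `1`-minimal model map for `A`: a `1`-equivalence `M → A` with `M` a `1`-minimal cdga. -/
def Hom.IsOneMinimalModelMap (f : Hom A B) : Prop :=
  A.IsOneMinimal ∧ f.IsEquivalence 1

/-! ### Inductive limits of cdgas -/

variable (k) in
/-- A sequence of cdgas `C 0 → C 1 → C 2 → ⋯`, given as a functor on the ordered set `ℕ`. -/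
structure Tower where
  obj : ℕ → CDGA.{u, v} k
  map : ∀ i j : ℕ, i ≤ j → Hom (obj i) (obj j)
  map_id : ∀ i, map i i le_rfl = Hom.id (obj i)
  map_comp : ∀ i j l (hij : i ≤ j) (hjl : j ≤ l),
    (map j l hjl).comp (map i j hij) = map i l (hij.trans hjl)

namespace Tower

variable (T : Tower.{u, v} k)

/-- The underlying maps of algebras. -/
abbrev algMap (i j : ℕ) (h : i ≤ j) : (T.obj i).carrier →ₐ[k] (T.obj j).carrier :=
  (T.map i j h).toAlgHom

instance : DirectedSystem (fun i => (T.obj i).carrier) (fun i j h => T.algMap i j h) where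
  map_self i x := by
    change (T.map i i le_rfl).toAlgHom x = x
    rw [T.map_id]; rfl
  map_map l j i hij hjl x := by
    change (T.map j l hjl).toAlgHom ((T.map i j hij).toAlgHom x) = (T.map i l _).toAlgHom x
    rw [← T.map_comp i j l hij hjl]; rfl

/-- The inductive limit of the underlying algebras. -/
abbrev LimCarrier : Type v := DirectLimit (fun i => (T.obj i).carrier) T.algMap

/-- The canonical maps of algebras into the limit. -/
def toLimAlg (i : ℕ) : (T.obj i).carrier →ₐ[k] T.LimCarrier where
  toFun x := ⟦⟨i, x⟩⟧
  map_one' := (DirectLimit.one_def i).symm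
  map_mul' _ _ := (DirectLimit.mul_def ..).symm
  map_zero' := (DirectLimit.zero_def i).symm
  map_add' _ _ := (DirectLimit.add_def ..).symm
  commutes' r := (DirectLimit.algebraMap_def i r).symm

theorem toLimAlg_map (i j : ℕ) (h : i ≤ j) (x : (T.obj i).carrier) :
    T.toLimAlg j (T.algMap i j h x) = T.toLimAlg i x := by
  change (⟦⟨j, T.algMap i j h x⟩⟧ : T.LimCarrier) = ⟦⟨i, x⟩⟧
  exact (DirectLimit.eq_of_le (f := T.algMap) ⟨i, x⟩ j h).symm

theorem exists_toLimAlg (x : T.LimCarrier) : ∃ i y, x = T.toLimAlg i y :=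
  DirectLimit.exists_eq_mk T.algMap x

theorem exists_toLimAlg_le (i : ℕ) (x : T.LimCarrier) : ∃ j, i ≤ j ∧ ∃ y, x = T.toLimAlg j y := by
  obtain ⟨l, y, rfl⟩ := T.exists_toLimAlg x
  exact ⟨max i l, le_max_left _ _, _, (T.toLimAlg_map l _ (le_max_right i l) y).symm⟩

/-- The linear map out of the limit defined by a compatible family. -/
def limLift {P : Type w} [AddCommMonoid P] [Module k P]
    (g : ∀ i, (T.obj i).carrier →ₗ[k] P)
    (hg : ∀ i j h x, g j (T.algMap i j h x) = g i x) : T.LimCarrier →ₗ[k] P :=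
  DirectLimit.Module.lift k ℕ (fun i => (T.obj i).carrier) T.algMap g hg

theorem limLift_toLimAlg {P : Type w} [AddCommMonoid P] [Module k P]
    (g : ∀ i, (T.obj i).carrier →ₗ[k] P)
    (hg : ∀ i j h x, g j (T.algMap i j h x) = g i x) (i : ℕ) (x : (T.obj i).carrier) :
    T.limLift g hg (T.toLimAlg i x) = g i x := rfl

/-- The differential of the limit. -/
def limD : T.LimCarrier →ₗ[k] T.LimCarrier :=
  T.limLift (fun i => (T.toLimAlg i).toLinearMap ∘ₗ (T.obj i).d) fun i j h x => by
    change T.toLimAlg j ((T.obj j).d ((T.map i j h).toAlgHom x)) = T.toLimAlg i ((T.obj i).d x)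
    rw [← (T.map i j h).map_d, T.toLimAlg_map]

theorem limD_toLimAlg (i : ℕ) (x : (T.obj i).carrier) :
    T.limD (T.toLimAlg i x) = T.toLimAlg i ((T.obj i).d x) := rfl

/-- The degree `n` part of the limit. -/
def limDeg (n : ℕ) : Submodule k T.LimCarrier where
  carrier := {x | ∃ i, ∃ y ∈ (T.obj i).deg n, x = T.toLimAlg i y}
  zero_mem' := ⟨0, 0, Submodule.zero_mem _, (map_zero _).symm⟩
  add_mem' := by
    rintro _ _ ⟨i, y, hy, rfl⟩ ⟨j, z, hz, rfl⟩
    refine ⟨max i j, _, Submodule.add_mem _ ((T.map i _ (le_max_left i j)).map_deg hy)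
      ((T.map j _ (le_max_right i j)).map_deg hz), ?_⟩
    rw [map_add, T.toLimAlg_map, T.toLimAlg_map]
  smul_mem' := by
    rintro c _ ⟨i, y, hy, rfl⟩
    exact ⟨i, c • y, Submodule.smul_mem _ c hy, (map_smul _ c y).symm⟩

theorem toLimAlg_mem {i n : ℕ} {y : (T.obj i).carrier} (hy : y ∈ (T.obj i).deg n) :
    T.toLimAlg i y ∈ T.limDeg n := ⟨i, y, hy, rfl⟩

instance : SetLike.GradedMonoid T.limDeg where
  one_mem := ⟨0, 1, SetLike.GradedOne.one_mem, (map_one _).symm⟩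
  mul_mem := by
    rintro m n _ _ ⟨i, y, hy, rfl⟩ ⟨j, z, hz, rfl⟩
    refine ⟨max i j, _, SetLike.GradedMul.mul_mem ((T.map i _ (le_max_left i j)).map_deg hy)
      ((T.map j _ (le_max_right i j)).map_deg hz), ?_⟩
    rw [map_mul, T.toLimAlg_map, T.toLimAlg_map]

/-- The map `⨁ₙ (C i)ⁿ → ⨁ₙ (lim C)ⁿ`. -/
def limDegMap (i : ℕ) : (⨁ n, (T.obj i).deg n) →ₗ[k] ⨁ n, T.limDeg n :=
  DirectSum.lmap fun n => (T.toLimAlg i).toLinearMap.restrict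
    (p := (T.obj i).deg n) (q := T.limDeg n) fun _ hy => T.toLimAlg_mem hy

theorem limDegMap_decompose_of_mem {i n : ℕ} {y : (T.obj i).carrier} (hy : y ∈ (T.obj i).deg n) :
    T.limDegMap i (DirectSum.decompose (T.obj i).deg y) =
      DirectSum.lof k ℕ (fun n => T.limDeg n) n ⟨T.toLimAlg i y, T.toLimAlg_mem hy⟩ := by
  rw [DirectSum.decompose_of_mem _ hy, ← DirectSum.lof_eq_of k]
  exact DirectSum.lmap_lof _ _ _

theorem limDegMap_decompose_map (i j : ℕ) (h : i ≤ j) (x : (T.obj i).carrier) :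
    T.limDegMap j (DirectSum.decompose (T.obj j).deg (T.algMap i j h x)) =
      T.limDegMap i (DirectSum.decompose (T.obj i).deg x) := by
  induction x using DirectSum.Decomposition.inductionOn (T.obj i).deg with
  | zero => simp
  | add x y hx hy => simp only [map_add, DirectSum.decompose_add, hx, hy]
  | @homogeneous n x =>
    rw [T.limDegMap_decompose_of_mem x.2,
      T.limDegMap_decompose_of_mem ((T.map i j h).map_deg x.2)]
    congr 2
    exact T.toLimAlg_map i j h x

/-- The decomposition of an element of the limit into its homogeneous components. -/
def limDecompose : T.LimCarrier →ₗ[k] ⨁ n, T.limDeg n :=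
  T.limLift (fun i => T.limDegMap i ∘ₗ (DirectSum.decomposeLinearEquiv (T.obj i).deg).toLinearMap)
    fun i j h x => T.limDegMap_decompose_map i j h x

theorem limDecompose_toLimAlg_of_mem {i n : ℕ} {y : (T.obj i).carrier}
    (hy : y ∈ (T.obj i).deg n) :
    T.limDecompose (T.toLimAlg i y) =
      DirectSum.lof k ℕ (fun n => T.limDeg n) n ⟨T.toLimAlg i y, T.toLimAlg_mem hy⟩ :=
  T.limDegMap_decompose_of_mem hy

instance limGraded : GradedAlgebra T.limDeg where
  toDecomposition := DirectSum.Decomposition.ofLinearMap T.limDeg T.limDecompose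
    (by
      refine LinearMap.ext fun x => ?_
      obtain ⟨i, y, rfl⟩ := T.exists_toLimAlg x
      simp only [LinearMap.comp_apply, LinearMap.id_apply]
      induction y using DirectSum.Decomposition.inductionOn (T.obj i).deg with
      | zero => simp
      | add x y hx hy => simp only [map_add, hx, hy]
      | @homogeneous n x =>
        rw [T.limDecompose_toLimAlg_of_mem x.2, DirectSum.coeLinearMap_lof])
    (by
      refine DirectSum.linearMap_ext k fun n => ?_
      ext1 ⟨x, hx⟩
      obtain ⟨i, y, hy, rfl⟩ := hx
      simp only [LinearMap.comp_apply, LinearMap.id_apply, DirectSum.coeLinearMap_lof]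
      exact T.limDecompose_toLimAlg_of_mem hy)

/-- The inductive limit of a sequence of cdgas. -/
abbrev lim : CDGA.{u, v} k where
  carrier := T.LimCarrier
  deg := T.limDeg
  d := T.limD
  d_mem := by
    rintro n _ ⟨i, y, hy, rfl⟩
    exact ⟨i, _, (T.obj i).d_mem hy, rfl⟩
  d_d a := by
    obtain ⟨i, y, rfl⟩ := T.exists_toLimAlg a
    rw [limD_toLimAlg, limD_toLimAlg, (T.obj i).d_d, map_zero]
  leibniz := by
    rintro n _ ⟨i, y, hy, rfl⟩ b
    obtain ⟨j, hij, z, rfl⟩ := T.exists_toLimAlg_le i b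
    rw [← T.toLimAlg_map i j hij y]
    have h := congrArg (T.toLimAlg j) ((T.obj j).leibniz ((T.map i j hij).map_deg hy) z)
    simp only [map_mul, map_add, map_pow, map_neg, map_one] at h
    rw [← map_mul, limD_toLimAlg, limD_toLimAlg, limD_toLimAlg]
    exact h
  mul_comm := by
    rintro m n _ _ ⟨i, y, hy, rfl⟩ ⟨j, z, hz, rfl⟩
    have h := congrArg (T.toLimAlg (max i j)) ((T.obj (max i j)).mul_comm
      ((T.map i _ (le_max_left i j)).map_deg hy) ((T.map j _ (le_max_right i j)).map_deg hz))
    rw [map_mul, map_mul, map_mul, T.toLimAlg_map, T.toLimAlg_map] at h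
    simpa using h

/-- The canonical maps into the inductive limit. -/
def toLim (i : ℕ) : Hom (T.obj i) T.lim where
  toAlgHom := T.toLimAlg i
  map_deg hy := T.toLimAlg_mem hy
  map_d _ := rfl

/-- The map of algebras out of the limit defined by a compatible family. -/
def limLiftAlg {P : Type w} [Ring P] [Algebra k P] (g : ∀ i, (T.obj i).carrier →ₐ[k] P)
    (hg : ∀ i j h x, g j (T.algMap i j h x) = g i x) : T.LimCarrier →ₐ[k] P :=
  AlgHom.ofLinearMap (T.limLift (fun i => (g i).toLinearMap) hg)
    (by
      rw [← map_one (T.toLimAlg 0)]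
      exact map_one (g 0))
    (fun x y => by
      obtain ⟨i, x, rfl⟩ := T.exists_toLimAlg x
      obtain ⟨j, hij, y, rfl⟩ := T.exists_toLimAlg_le i y
      rw [← T.toLimAlg_map i j hij x, ← map_mul]
      exact map_mul (g j) _ _)

/-- The map out of the inductive limit defined by a compatible family of cdga maps. -/
def lift {B : CDGA.{u, w} k} (g : ∀ i, Hom (T.obj i) B)
    (hg : ∀ i j h, (g j).comp (T.map i j h) = g i) : Hom T.lim B where
  toAlgHom := T.limLiftAlg (fun i => (g i).toAlgHom) fun i j h x => by rw [← hg i j h]; rfl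
  map_deg := by
    rintro n _ ⟨i, y, hy, rfl⟩
    exact (g i).map_deg hy
  map_d := fun x => by
    obtain ⟨i, x, rfl⟩ := T.exists_toLimAlg x
    exact (g i).map_d x

theorem lift_toLim {B : CDGA.{u, w} k} (g : ∀ i, Hom (T.obj i) B)
    (hg : ∀ i j h, (g j).comp (T.map i j h) = g i) (i : ℕ) :
    (T.lift g hg).comp (T.toLim i) = g i := rfl

end Tower

end CDGA

end

noncomputable section

/-! ### The Chevalley–Eilenberg cochain algebra -/

namespace ExteriorAlgebra

variable {k : Type u} [Field k] {V : Type v} [AddCommGroup V] [Module k V]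

theorem ι_mem_one (x : V) : ι k x ∈ ⋀[k]^1 V := by
  simpa only [pow_one] using LinearMap.mem_range_self _ x

theorem ι_mul_of_mem (x : V) {i : ℕ} {a : ExteriorAlgebra k V} (ha : a ∈ ⋀[k]^i V) :
    ι k x * a = (-1) ^ i * (a * ι k x) := by
  induction ha using Submodule.pow_induction_on_left' with
  | algebraMap r => simpa using Algebra.commutes' r (ι k x) |>.symm
  | add y z i hy hz ihy ihz => rw [mul_add, add_mul, mul_add, ihy, ihz]
  | mem_mul m hm i y hy ih =>
    obtain ⟨m, rfl⟩ := hm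
    have h : ι k x * ι k m = -(ι k m * ι k x) := eq_neg_of_add_eq_zero_left (ι_add_mul_swap x m)
    rw [← mul_assoc, h, neg_mul, mul_assoc, ih, pow_succ]
    rcases neg_one_pow_eq_or (ExteriorAlgebra k V) i with h | h <;> rw [h] <;>
      simp [mul_assoc]

theorem mul_comm_of_mem {i j : ℕ} {a b : ExteriorAlgebra k V} (ha : a ∈ ⋀[k]^i V)
    (hb : b ∈ ⋀[k]^j V) : a * b = (-1) ^ (i * j) * (b * a) := by
  induction ha using Submodule.pow_induction_on_left' with
  | algebraMap r => simpa using Algebra.commutes' r b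
  | add y z i hy hz ihy ihz => rw [mul_add, add_mul, mul_add, ihy, ihz]
  | mem_mul m hm i y hy ih =>
    obtain ⟨m, rfl⟩ := hm
    rw [mul_assoc, ih, Nat.succ_mul, pow_add]
    rcases neg_one_pow_eq_or (ExteriorAlgebra k V) (i * j) with h | h <;> rw [h] <;>
      simp only [one_mul, neg_mul, mul_neg, ← mul_assoc, ι_mul_of_mem m hb]

/-- The extension of a linear map `δ : V → ⋀² V` to `⋀ V` by the graded Leibniz rule. -/
def antiderivation (δ : V →ₗ[k] ExteriorAlgebra k V) (hδ : ∀ x, δ x ∈ ⋀[k]^2 V) :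
    ExteriorAlgebra k V →ₗ[k] ExteriorAlgebra k V :=
  CliffordAlgebra.foldr' (0 : QuadraticForm k V)
    { toFun := fun x => LinearMap.mulLeft k (δ x) ∘ₗ LinearMap.fst k _ _ -
        LinearMap.mulLeft k (ι k x) ∘ₗ LinearMap.snd k _ _
      map_add' := fun x y => by
        refine LinearMap.ext fun z => ?_
        simp [add_mul]; abel
      map_smul' := fun c x => by
        refine LinearMap.ext fun z => ?_
        simp [smul_sub] }
    (fun x a b => by
      have h : ι k x * δ x = δ x * ι k x := by simpa using ι_mul_of_mem x (hδ x)
      have h2 : ι k x * ι k x = 0 := ι_sq_zero x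
      change δ x * (ι k x * a) - ι k x * (δ x * a - ι k x * b) = (0 : k) • b
      rw [mul_sub, ← mul_assoc, ← mul_assoc, ← mul_assoc, h, h2]
      simp)
    0

section antiderivation

variable (δ : V →ₗ[k] ExteriorAlgebra k V) (hδ : ∀ x, δ x ∈ ⋀[k]^2 V)

theorem antiderivation_ι_mul (x : V) (a : ExteriorAlgebra k V) :
    antiderivation δ hδ (ι k x * a) = δ x * a - ι k x * antiderivation δ hδ a :=
  CliffordAlgebra.foldr'_ι_mul _ _ _ _ x a

theorem antiderivation_algebraMap (r : k) :
    antiderivation δ hδ (algebraMap k _ r) = 0 :=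
  (CliffordAlgebra.foldr'_algebraMap _ _ _ _ r).trans (smul_zero r)

theorem antiderivation_ι (x : V) : antiderivation δ hδ (ι k x) = δ x := by
  have h := antiderivation_ι_mul δ hδ x 1
  have h1 : antiderivation δ hδ 1 = 0 := by
    simpa using antiderivation_algebraMap δ hδ 1
  simpa [h1] using h

theorem antiderivation_mem {i : ℕ} {a : ExteriorAlgebra k V} (ha : a ∈ ⋀[k]^i V) :
    antiderivation δ hδ a ∈ ⋀[k]^(i + 1) V := by
  induction ha using Submodule.pow_induction_on_left' with
  | algebraMap r => rw [antiderivation_algebraMap]; exact Submodule.zero_mem _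
  | add y z i hy hz ihy ihz => rw [map_add]; exact Submodule.add_mem _ ihy ihz
  | mem_mul m hm i y hy ih =>
    obtain ⟨m, rfl⟩ := hm
    rw [antiderivation_ι_mul]
    refine Submodule.sub_mem _ ?_ ?_
    · have h : (i + 1 + 1) = 2 + i := by ring
      rw [h]
      exact SetLike.GradedMul.mul_mem (A := fun i : ℕ => ⋀[k]^i V) (hδ m) hy
    · have h : (i + 1 + 1) = 1 + (i + 1) := by ring
      rw [h]
      exact SetLike.GradedMul.mul_mem (A := fun i : ℕ => ⋀[k]^i V) (ι_mem_one m) ih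

theorem antiderivation_mul {i : ℕ} {a : ExteriorAlgebra k V} (ha : a ∈ ⋀[k]^i V)
    (b : ExteriorAlgebra k V) :
    antiderivation δ hδ (a * b) =
      antiderivation δ hδ a * b + (-1) ^ i * (a * antiderivation δ hδ b) := by
  induction ha using Submodule.pow_induction_on_left' with
  | algebraMap r =>
    rw [antiderivation_algebraMap, ← Algebra.smul_def, ← Algebra.smul_def, map_smul]
    simp
  | add y z i hy hz ihy ihz =>
    rw [add_mul, map_add, map_add, ihy, ihz, add_mul, add_mul, mul_add]
    abel
  | mem_mul m hm i y hy ih =>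
    obtain ⟨m, rfl⟩ := hm
    rw [mul_assoc, antiderivation_ι_mul, antiderivation_ι_mul, ih, pow_succ]
    rcases neg_one_pow_eq_or (ExteriorAlgebra k V) i with h | h <;> rw [h] <;>
      simp only [mul_add, sub_mul, mul_assoc, one_mul, neg_mul, mul_neg, neg_neg] <;> abel

theorem antiderivation_antiderivation (h : ∀ x, antiderivation δ hδ (δ x) = 0)
    (a : ExteriorAlgebra k V) : antiderivation δ hδ (antiderivation δ hδ a) = 0 := by
  induction a using CliffordAlgebra.left_induction with
  | algebraMap r => 
    change antiderivation δ hδ (antiderivation δ hδ (algebraMap k _ r)) = 0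
    rw [antiderivation_algebraMap, map_zero]
  | add y z hy hz => rw [map_add, map_add, hy, hz, add_zero]
  | ι_mul y x ih =>
    change antiderivation δ hδ (antiderivation δ hδ (ι k x * y)) = 0
    rw [antiderivation_ι_mul, map_sub, antiderivation_mul δ hδ (hδ x), antiderivation_ι_mul, ih, h]
    simp

end antiderivation

end ExteriorAlgebra

section dualTensor

variable {k : Type u} [Field k] {V : Type v} [AddCommGroup V] [Module k V] [FiniteDimensional k V]

/-- The canonical isomorphism `(V ⊗ V)* ≅ V* ⊗ V*` for a finite-dimensional space `V`. It sends
the alternating forms on `V` to the antisymmetric tensors, that is, to the elements of `V* ∧ V*`,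
embedded in `V* ⊗ V*` by `x ∧ y ↦ x ⊗ y - y ⊗ x`. -/
def dualTensor : Module.Dual k (V ⊗[k] V) →ₗ[k] Module.Dual k V ⊗[k] Module.Dual k V :=
  (TensorProduct.dualDistribEquiv k V V).symm.toLinearMap

theorem dualDistrib_dualTensor (B : Module.Dual k (V ⊗[k] V)) :
    TensorProduct.dualDistrib k V V (dualTensor B) = B :=
  (TensorProduct.dualDistribEquiv k V V).apply_symm_apply _

theorem dualTensor_dualDistrib (t : Module.Dual k V ⊗[k] Module.Dual k V) :
    dualTensor (TensorProduct.dualDistrib k V V t) = t :=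
  (TensorProduct.dualDistribEquiv k V V).symm_apply_apply _

theorem dualTensor_eq_sum {ι : Type*} [Fintype ι] [DecidableEq ι] (b : Module.Basis ι k V)
    (B : Module.Dual k (V ⊗[k] V)) :
    dualTensor B = ∑ i, ∑ j, B (b i ⊗ₜ b j) • (b.coord i ⊗ₜ[k] b.coord j) := by
  have h := congrArg dualTensor (LinearMap.congr_fun
    (TensorProduct.dualDistrib_dualDistribInvOfBasis_left_inverse (R := k) b b) B)
  rw [LinearMap.comp_apply, dualTensor_dualDistrib, LinearMap.id_apply,
    TensorProduct.dualDistribInvOfBasis_apply] at h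
  simpa using h.symm

theorem dualTensor_natural {W : Type w} [AddCommGroup W] [Module k W] [FiniteDimensional k W]
    (φ : V →ₗ[k] W) (B : Module.Dual k (W ⊗[k] W)) :
    dualTensor ((TensorProduct.map φ φ).dualMap B) =
      TensorProduct.map φ.dualMap φ.dualMap (dualTensor B) := by
  rw [← dualTensor_dualDistrib (TensorProduct.map φ.dualMap φ.dualMap (dualTensor B))]
  congr 1
  conv_lhs => rw [← dualDistrib_dualTensor B]
  generalize dualTensor B = t
  induction t with
  | zero => simp
  | add x y hx hy => simp only [map_add, hx, hy]
  | tmul x y => exact TensorProduct.ext' fun v w => rfl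

end dualTensor

namespace LieAlgebra

variable (k : Type u) [Field k] (g : Type v) [LieRing g] [LieAlgebra k g]

/-- The Lie bracket `x ⊗ y ↦ [x, y]`, as a linear map `β : g ⊗ g → g`. -/
def bracketMap : g ⊗[k] g →ₗ[k] g :=
  TensorProduct.lift (LieModule.toEnd k g g : g →ₗ[k] g →ₗ[k] g)

variable {k g} in
@[simp]
theorem bracketMap_tmul (x y : g) : bracketMap k g (x ⊗ₜ y) = ⁅x, y⁆ := rfl

variable [FiniteDimensional k g]

/-- The Chevalley–Eilenberg differential on the generators: `d ξ ∈ g* ∧ g*` is `-β*(ξ)`, the form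
`(x, y) ↦ -ξ([x, y])`. As the wedge `ξ ∧ η` is the antisymmetric tensor `ξ ⊗ η - η ⊗ ξ`, the product
`g* ⊗ g* → ⋀² g*` is here multiplied by `1/2`. -/
def cochainDifferentialGen : Module.Dual k g →ₗ[k] ExteriorAlgebra k (Module.Dual k g) :=
  -((1 / 2 : k) • (LinearMap.mul' k (ExteriorAlgebra k (Module.Dual k g)) ∘ₗ
    TensorProduct.map (ExteriorAlgebra.ι k) (ExteriorAlgebra.ι k) ∘ₗ dualTensor ∘ₗ
      (bracketMap k g).dualMap))

theorem cochainDifferentialGen_mem (ξ : Module.Dual k g) :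
    cochainDifferentialGen k g ξ ∈ ⋀[k]^2 (Module.Dual k g) := by
  refine Submodule.neg_mem _ (Submodule.smul_mem _ _ ?_)
  simp only [LinearMap.comp_apply]
  generalize dualTensor ((bracketMap k g).dualMap ξ) = t
  induction t with
  | zero => simp
  | add x y hx hy => simp only [map_add]; exact Submodule.add_mem _ hx hy
  | tmul x y =>
    rw [TensorProduct.map_tmul, LinearMap.mul'_apply]
    exact SetLike.GradedMul.mul_mem (A := fun i : ℕ => ⋀[k]^i (Module.Dual k g))
      (ExteriorAlgebra.ι_mem_one x) (ExteriorAlgebra.ι_mem_one y)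

/-- The Chevalley–Eilenberg differential on `⋀ g*`. -/
def cochainDifferential :
    ExteriorAlgebra k (Module.Dual k g) →ₗ[k] ExteriorAlgebra k (Module.Dual k g) :=
  ExteriorAlgebra.antiderivation (cochainDifferentialGen k g) (cochainDifferentialGen_mem k g)

theorem cochainDifferentialGen_eq_sum {ι : Type*} [Fintype ι] [DecidableEq ι]
    (b : Module.Basis ι k g) (ξ : Module.Dual k g) :
    cochainDifferentialGen k g ξ = -((1 / 2 : k) • ∑ i, ∑ j, ξ ⁅b i, b j⁆ •
      (ExteriorAlgebra.ι k (b.coord i) * ExteriorAlgebra.ι k (b.coord j))) := by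
  have h : cochainDifferentialGen k g ξ =
      -((1 / 2 : k) • (LinearMap.mul' k (ExteriorAlgebra k (Module.Dual k g))
        (TensorProduct.map (ExteriorAlgebra.ι k) (ExteriorAlgebra.ι k)
          (dualTensor ((bracketMap k g).dualMap ξ))))) := rfl
  rw [h, dualTensor_eq_sum b]
  simp only [map_sum, map_smul, TensorProduct.map_tmul, LinearMap.mul'_apply,
    LinearMap.dualMap_apply, bracketMap_tmul]

theorem sum_cyclic_eq_zero {E : Type w} [AddCommGroup E] [Module k E] [CharZero k]
    {ι : Type*} [Fintype ι] (c : ι → ι → ι → k) (t : ι → ι → ι → E)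
    (ht : ∀ i j l, t i j l = t j l i) (hc : ∀ i j l, c i j l + c j l i + c l i j = 0) :
    ∑ i, ∑ j, ∑ l, c i j l • t i j l = 0 := by
  have hrot : ∀ f : ι → ι → ι → E, ∑ i, ∑ j, ∑ l, f j l i = ∑ i, ∑ j, ∑ l, f i j l := fun f =>
    Finset.sum_comm.trans (Finset.sum_congr rfl fun j _ => Finset.sum_comm)
  have h1 : ∑ i, ∑ j, ∑ l, c j l i • t i j l = ∑ i, ∑ j, ∑ l, c i j l • t i j l := by
    rw [← hrot fun i j l => c i j l • t i j l]
    simp only [← ht]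
  have h2 : ∑ i, ∑ j, ∑ l, c l i j • t i j l = ∑ i, ∑ j, ∑ l, c i j l • t i j l := by
    rw [← h1, ← hrot fun i j l => c j l i • t i j l]
    simp only [← ht]
  have h3 : ∑ i, ∑ j, ∑ l, (c i j l + c j l i + c l i j) • t i j l = 0 := by
    simp only [hc, zero_smul, Finset.sum_const_zero]
  simp only [add_smul, Finset.sum_add_distrib, h1, h2] at h3
  generalize ∑ i, ∑ j, ∑ l, c i j l • t i j l = S at h3
  have h4 : (3 : k) • S = 0 := by
    rw [← h3, show (3 : k) = 1 + 1 + 1 by norm_num, add_smul, add_smul, one_smul]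
  exact (smul_eq_zero.mp h4).resolve_left (by norm_num)

theorem cochainDifferential_gen [CharZero k] (ξ : Module.Dual k g) :
    cochainDifferential k g (cochainDifferentialGen k g ξ) = 0 := by
  classical
  let b := Module.finBasis k g
  let e : Fin (Module.finrank k g) → ExteriorAlgebra k (Module.Dual k g) :=
    fun i => ExteriorAlgebra.ι k (b.coord i)
  let D : Fin (Module.finrank k g) → ExteriorAlgebra k (Module.Dual k g) :=
    fun i => cochainDifferentialGen k g (b.coord i)
  have hanti : ∀ i j, e i * e j = -(e j * e i) := fun i j =>
    eq_neg_of_add_eq_zero_left (ExteriorAlgebra.ι_add_mul_swap _ _)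
  have hcyc : ∀ i j l, e i * e j * e l = e j * e l * e i := fun i j l => by
    rw [hanti i j, neg_mul, mul_assoc, hanti i l, mul_neg, neg_neg, mul_assoc]
  have hD : ∀ i j, e i * D j = D j * e i := fun i j => by
    simpa using ExteriorAlgebra.ι_mul_of_mem (b.coord i) (cochainDifferentialGen_mem k g (b.coord j))
  have hd : ∀ i j, cochainDifferential k g (e i * e j) = D i * e j - D j * e i := fun i j => by
    rw [← hD i j]
    have h := ExteriorAlgebra.antiderivation_ι_mul (cochainDifferentialGen k g)
      (cochainDifferentialGen_mem k g) (b.coord i) (ExteriorAlgebra.ι k (b.coord j))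
    rwa [ExteriorAlgebra.antiderivation_ι] at h
  -- the functional `x ↦ ξ [x, b j]`
  let η : Fin (Module.finrank k g) → Module.Dual k g :=
    fun j => ξ ∘ₗ bracketMap k g ∘ₗ (TensorProduct.mk k g g).flip (b j)
  have hη : ∀ j x, η j x = ξ ⁅x, b j⁆ := fun j x => rfl
  have hη_sum : ∀ j, ∑ i, ξ ⁅b i, b j⁆ • D i = cochainDifferentialGen k g (η j) := fun j => by
    have h : ∑ i, ξ ⁅b i, b j⁆ • b.coord i = η j := by
      refine b.ext fun l => ?_
      simp [hη, Finsupp.single_apply]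
    rw [← h, map_sum]
    simp only [map_smul, D]
  have hjac : ∑ j, ∑ i, ∑ l, ξ ⁅⁅b i, b l⁆, b j⁆ • (e i * e l * e j) = 0 := by
    refine (Finset.sum_congr rfl fun j _ => Finset.sum_congr rfl fun i _ =>
      Finset.sum_congr rfl fun l _ => by rw [← hcyc]).trans
      (sum_cyclic_eq_zero k (fun j i l => ξ ⁅⁅b i, b l⁆, b j⁆) (fun j i l => e j * e i * e l)
        hcyc fun j i l => ?_)
    rw [← map_add, ← map_add]
    have h : ⁅⁅b i, b l⁆, b j⁆ + ⁅⁅b l, b j⁆, b i⁆ + ⁅⁅b j, b i⁆, b l⁆ = 0 := by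
      have := lie_jacobi (b i) (b l) (b j)
      rw [← lie_skew ⁅b i, b l⁆, ← lie_skew ⁅b l, b j⁆, ← lie_skew ⁅b j, b i⁆, ← neg_add, ← neg_add,
        neg_eq_zero, ← this]
      abel
    rw [h, map_zero]
  have hfirst : ∑ i, ∑ j, ξ ⁅b i, b j⁆ • (D i * e j) = 0 := by
    rw [Finset.sum_comm]
    have h : ∀ j, ∑ i, ξ ⁅b i, b j⁆ • (D i * e j) =
        -((1 / 2 : k) • ∑ i, ∑ l, ξ ⁅⁅b i, b l⁆, b j⁆ • (e i * e l * e j)) := fun j => by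
      simp only [← smul_mul_assoc]
      rw [← Finset.sum_mul, hη_sum, cochainDifferentialGen_eq_sum k g b]
      simp only [hη, neg_mul, smul_mul_assoc, Finset.sum_mul, e]
    simp only [h]
    rw [Finset.sum_neg_distrib, ← Finset.smul_sum, hjac, smul_zero, neg_zero]
  have hsecond : ∑ i, ∑ j, ξ ⁅b i, b j⁆ • (D j * e i) = 0 := by
    rw [Finset.sum_comm]
    have h : ∀ i j, ξ ⁅b i, b j⁆ • (D j * e i) = -(ξ ⁅b j, b i⁆ • (D j * e i)) := fun i j => by
      rw [← neg_smul, ← map_neg, lie_skew]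
    simp only [h, Finset.sum_neg_distrib, hfirst, neg_zero]
  rw [cochainDifferentialGen_eq_sum k g b ξ]
  have hsum : cochainDifferential k g (∑ i, ∑ j, ξ ⁅b i, b j⁆ • (e i * e j)) = 0 := by
    simp only [map_sum, map_smul, hd, smul_sub, Finset.sum_sub_distrib, hfirst, hsecond, sub_zero]
  rw [map_neg, map_smul, hsum, smul_zero, neg_zero]

end LieAlgebra

namespace CDGA

variable {k : Type u} [Field k]

/-- A map of algebras `⋀ V → B` which sends `V` to `B¹` preserves degrees. -/
theorem exterior_map_deg {V : Type v} [AddCommGroup V] [Module k V] {B : CDGA.{u, w} k}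
    (F : ExteriorAlgebra k V →ₐ[k] B.carrier) (hF : ∀ x, F (ExteriorAlgebra.ι k x) ∈ B.deg 1)
    {i : ℕ} {a : ExteriorAlgebra k V} (ha : a ∈ ⋀[k]^i V) : F a ∈ B.deg i := by
  induction ha using Submodule.pow_induction_on_left' with
  | algebraMap r =>
    rw [AlgHom.commutes, Algebra.algebraMap_eq_smul_one]
    exact Submodule.smul_mem _ _ SetLike.GradedOne.one_mem
  | add y z i hy hz ihy ihz => rw [map_add]; exact Submodule.add_mem _ ihy ihz
  | mem_mul m hm i y hy ih =>
    obtain ⟨m, rfl⟩ := hm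
    rw [map_mul, Nat.succ_eq_one_add]
    exact SetLike.GradedMul.mul_mem (hF m) ih

theorem d_algebraMap (A : CDGA.{u, v} k) (r : k) : A.d (algebraMap k A.carrier r) = 0 := by
  have h := A.leibniz (i := 0) SetLike.GradedOne.one_mem (1 : A.carrier)
  simp only [mul_one, one_mul, pow_zero] at h
  rw [Algebra.algebraMap_eq_smul_one, map_smul, left_eq_add.mp h, smul_zero]

/-- A map of algebras `⋀ V → B` which sends `V` to `B¹` and commutes with the differentials on `V`
commutes with the differentials. -/
theorem exterior_map_d {V : Type v} [AddCommGroup V] [Module k V] {B : CDGA.{u, w} k}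
    (F : ExteriorAlgebra k V →ₐ[k] B.carrier) (hF : ∀ x, F (ExteriorAlgebra.ι k x) ∈ B.deg 1)
    (δ : V →ₗ[k] ExteriorAlgebra k V) (hδ : ∀ x, δ x ∈ ⋀[k]^2 V)
    (hd : ∀ x, F (δ x) = B.d (F (ExteriorAlgebra.ι k x))) (a : ExteriorAlgebra k V) :
    F (ExteriorAlgebra.antiderivation δ hδ a) = B.d (F a) := by
  induction a using CliffordAlgebra.left_induction with
  | algebraMap r =>
    change F (ExteriorAlgebra.antiderivation δ hδ (algebraMap k _ r)) = B.d (F (algebraMap k _ r))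
    rw [ExteriorAlgebra.antiderivation_algebraMap, map_zero, AlgHom.commutes, d_algebraMap]
  | add y z hy hz => simp only [map_add, hy, hz]
  | ι_mul y x ih =>
    change F (ExteriorAlgebra.antiderivation δ hδ (ExteriorAlgebra.ι k x * y)) =
      B.d (F (ExteriorAlgebra.ι k x * y))
    rw [ExteriorAlgebra.antiderivation_ι_mul, map_sub, map_mul, map_mul, map_mul,
      B.leibniz (hF x), hd, ih]
    simp [sub_eq_add_neg]

section cochains

variable (k) [CharZero k] (g : Type v) [LieRing g] [LieAlgebra k g] [FiniteDimensional k g]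

/-- The Chevalley–Eilenberg cochain cdga `C(g) = (⋀ g*, d)` of a finite-dimensional Lie algebra. -/
abbrev cochains : CDGA.{u, max u v} k where
  carrier := ExteriorAlgebra k (Module.Dual k g)
  deg i := ⋀[k]^i (Module.Dual k g)
  d := LieAlgebra.cochainDifferential k g
  d_mem ha := ExteriorAlgebra.antiderivation_mem _ _ ha
  d_d := ExteriorAlgebra.antiderivation_antiderivation _ _ (LieAlgebra.cochainDifferential_gen k g)
  leibniz ha b := ExteriorAlgebra.antiderivation_mul _ _ ha b
  mul_comm ha hb := ExteriorAlgebra.mul_comm_of_mem ha hb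

end cochains

section cochainsMap

variable {g : Type v} [LieRing g] [LieAlgebra k g] [FiniteDimensional k g]
variable {g' : Type v₁} [LieRing g'] [LieAlgebra k g'] [FiniteDimensional k g']
variable {g'' : Type v₂} [LieRing g''] [LieAlgebra k g''] [FiniteDimensional k g'']

theorem map_cochainDifferentialGen (φ : g →ₗ⁅k⁆ g') (ξ : Module.Dual k g') :
    ExteriorAlgebra.map (φ : g →ₗ[k] g').dualMap (LieAlgebra.cochainDifferentialGen k g' ξ) =
      LieAlgebra.cochainDifferentialGen k g ((φ : g →ₗ[k] g').dualMap ξ) := by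
  have h : (LieAlgebra.bracketMap k g).dualMap ((φ : g →ₗ[k] g').dualMap ξ) =
      (TensorProduct.map (φ : g →ₗ[k] g') (φ : g →ₗ[k] g')).dualMap
        ((LieAlgebra.bracketMap k g').dualMap ξ) := by
    refine TensorProduct.ext' fun x y => ?_
    simp
  simp only [LieAlgebra.cochainDifferentialGen, LinearMap.neg_apply, LinearMap.smul_apply,
    LinearMap.comp_apply, h, dualTensor_natural, map_neg, map_smul]
  congr 2
  generalize dualTensor ((LieAlgebra.bracketMap k g').dualMap ξ) = t
  induction t with
  | zero => simp
  | add x y hx hy => simp only [map_add, hx, hy]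
  | tmul x y => simp

theorem map_ι_mem_one {V : Type v} [AddCommGroup V] [Module k V] {W : Type w} [AddCommGroup W]
    [Module k W] (f : V →ₗ[k] W) (x : V) :
    ExteriorAlgebra.map f (ExteriorAlgebra.ι k x) ∈ ⋀[k]^1 W := by
  rw [ExteriorAlgebra.map_apply_ι]
  exact ExteriorAlgebra.ι_mem_one _

theorem map_cochainDifferential_ι (φ : g →ₗ⁅k⁆ g') (ξ : Module.Dual k g') :
    ExteriorAlgebra.map (φ : g →ₗ[k] g').dualMap (LieAlgebra.cochainDifferentialGen k g' ξ) =
      LieAlgebra.cochainDifferential k g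
        (ExteriorAlgebra.map (φ : g →ₗ[k] g').dualMap (ExteriorAlgebra.ι k ξ)) := by
  rw [ExteriorAlgebra.map_apply_ι, map_cochainDifferentialGen]
  exact (ExteriorAlgebra.antiderivation_ι _ _ _).symm

variable [CharZero k]

/-- The functoriality of `C`: a Lie algebra map `φ : g → g'` induces `C(g') → C(g)`, the extension
of the dual map `g'* → g*`. -/
def cochainsMap (φ : g →ₗ⁅k⁆ g') : Hom (cochains k g') (cochains k g) where
  toAlgHom := ExteriorAlgebra.map (φ : g →ₗ[k] g').dualMap
  map_deg ha := exterior_map_deg (B := cochains k g) _ (map_ι_mem_one _) ha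
  map_d a := exterior_map_d (B := cochains k g) _ (map_ι_mem_one _) _
    (LieAlgebra.cochainDifferentialGen_mem k g') (map_cochainDifferential_ι φ) a

theorem cochainsMap_id : cochainsMap (LieHom.id : g →ₗ⁅k⁆ g) = Hom.id (cochains k g) :=
  Hom.ext (ExteriorAlgebra.map_id (R := k) (M := Module.Dual k g))

theorem cochainsMap_comp (φ : g →ₗ⁅k⁆ g') (ψ : g' →ₗ⁅k⁆ g'') :
    (cochainsMap φ).comp (cochainsMap ψ) = cochainsMap (ψ.comp φ) :=
  Hom.ext (ExteriorAlgebra.map_comp_map (ψ : g' →ₗ[k] g'').dualMap (φ : g →ₗ[k] g').dualMap)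

end cochainsMap

end CDGA
end

noncomputable section

/-! ### Free, quotient and finitely generated Lie algebras -/

namespace LieAlgebra

section quotient

variable {k : Type u} [Field k]
variable {L : Type v} [LieRing L] [LieAlgebra k L]
variable {L' : Type w} [LieRing L'] [LieAlgebra k L']

/-- The projection `L → L / I`. -/
def quotMk (I : LieIdeal k L) : L →ₗ⁅k⁆ L ⧸ I where
  toLinearMap := (LieSubmodule.Quotient.mk' I : L →ₗ[k] L ⧸ I)
  map_lie' := rfl

theorem quotMk_surjective (I : LieIdeal k L) : Function.Surjective (quotMk I) :=
  LieSubmodule.Quotient.surjective_mk' I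

theorem quotMk_eq_zero {I : LieIdeal k L} {x : L} : quotMk I x = 0 ↔ x ∈ I :=
  LieSubmodule.Quotient.mk_eq_zero (N := I)

/-- The map `L / I → L'` induced by a Lie algebra map `L → L'` which vanishes on `I`. -/
def quotLift (I : LieIdeal k L) (f : L →ₗ⁅k⁆ L') (hf : ∀ x ∈ I, f x = 0) : L ⧸ I →ₗ⁅k⁆ L' where
  toLinearMap := Submodule.liftQ I.toSubmodule (f : L →ₗ[k] L') hf
  map_lie' := by
    intro x y
    obtain ⟨x, rfl⟩ := quotMk_surjective I x
    obtain ⟨y, rfl⟩ := quotMk_surjective I y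
    exact LieHom.map_lie f x y

theorem quotLift_quotMk (I : LieIdeal k L) (f : L →ₗ⁅k⁆ L') (hf : ∀ x ∈ I, f x = 0) (x : L) :
    quotLift I f hf (quotMk I x) = f x := rfl

theorem quot_hom_ext {I : LieIdeal k L} {f f' : L ⧸ I →ₗ⁅k⁆ L'}
    (h : ∀ x, f (quotMk I x) = f' (quotMk I x)) : f = f' := by
  refine LieHom.ext fun x => ?_
  obtain ⟨x, rfl⟩ := quotMk_surjective I x
  exact h x

/-- The map `L / I → L' / I'` induced by a Lie algebra map `L → L'` which sends `I` into `I'`. -/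
def quotMap (I : LieIdeal k L) (I' : LieIdeal k L') (f : L →ₗ⁅k⁆ L') (hf : ∀ x ∈ I, f x ∈ I') :
    L ⧸ I →ₗ⁅k⁆ L' ⧸ I' :=
  quotLift I ((quotMk I').comp f) fun x hx =>
    (quotMk_eq_zero (I := I') (x := f x)).mpr (hf x hx)

end quotient

section free

variable (k : Type u) [Field k] (V : Type v) [AddCommGroup V] [Module k V]

/-- The ideal of the free Lie algebra on the set `V` which is generated by the relations that make
the inclusion of `V` linear. -/
def linearityIdeal : LieIdeal k (FreeLieAlgebra k V) :=
  LieSubmodule.lieSpan k (FreeLieAlgebra k V)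
    ({z | ∃ x y : V, z = FreeLieAlgebra.of k (x + y) - FreeLieAlgebra.of k x -
        FreeLieAlgebra.of k y} ∪
      {z | ∃ (c : k) (x : V), z = FreeLieAlgebra.of k (c • x) - c • FreeLieAlgebra.of k x})

/-- The free Lie algebra `𝕃(V)` on the vector space `V`. -/
abbrev FreeLie : Type (max u v) := FreeLieAlgebra k V ⧸ linearityIdeal k V

variable {V}

/-- The inclusion `V → 𝕃(V)`. -/
def FreeLie.ι : V →ₗ[k] FreeLie k V where
  toFun x := quotMk (linearityIdeal k V) (FreeLieAlgebra.of k x)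
  map_add' x y := by
    rw [← sub_eq_zero, ← sub_sub, ← map_sub, ← map_sub, quotMk_eq_zero]
    exact LieSubmodule.subset_lieSpan (Or.inl ⟨x, y, rfl⟩)
  map_smul' c x := by
    rw [RingHom.id_apply, ← sub_eq_zero, ← map_smul, ← map_sub, quotMk_eq_zero]
    exact LieSubmodule.subset_lieSpan (Or.inr ⟨c, x, rfl⟩)

variable {k}
variable {L : Type w} [LieRing L] [LieAlgebra k L]

/-- The universal property of `𝕃(V)`: a linear map `V → L` to a Lie algebra extends to `𝕃(V)`. -/
def FreeLie.lift (f : V →ₗ[k] L) : FreeLie k V →ₗ⁅k⁆ L :=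
  quotLift (linearityIdeal k V) (FreeLieAlgebra.lift k f) fun x hx => by
    have h : linearityIdeal k V ≤ (FreeLieAlgebra.lift k (f : V → L)).ker := by
      refine LieSubmodule.lieSpan_le.mpr ?_
      rintro _ (⟨x, y, rfl⟩ | ⟨c, x, rfl⟩) <;>
        simp [LieHom.mem_ker]
    exact LieHom.mem_ker.mp (h hx)

theorem FreeLie.lift_ι (f : V →ₗ[k] L) (x : V) : FreeLie.lift f (FreeLie.ι k x) = f x :=
  FreeLieAlgebra.lift_of_apply (f : V → L) x

theorem FreeLie.hom_ext {f f' : FreeLie k V →ₗ⁅k⁆ L}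
    (h : ∀ x, f (FreeLie.ι k x) = f' (FreeLie.ι k x)) : f = f' := by
  refine quot_hom_ext fun x => ?_
  have h' : f.comp (quotMk _) = f'.comp (quotMk _) := FreeLieAlgebra.hom_ext h
  exact LieHom.congr_fun h' x

end free

section finite

variable (k : Type u) [Field k] (L : Type v) [LieRing L] [LieAlgebra k L]

/-- The Lie algebra `L` is finitely generated. -/
class FinitelyGenerated : Prop where
  exists_lieSpan : ∃ s : Set L, s.Finite ∧ LieSubalgebra.lieSpan k L s = ⊤

variable {k L} in
theorem FinitelyGenerated.of_surjective [FinitelyGenerated k L] {L' : Type w} [LieRing L']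
    [LieAlgebra k L'] (f : L →ₗ⁅k⁆ L') (hf : Function.Surjective f) : FinitelyGenerated k L' := by
  obtain ⟨s, hs, h⟩ := FinitelyGenerated.exists_lieSpan (k := k) (L := L)
  refine ⟨f '' s, hs.image f, eq_top_iff.mpr fun y _ => ?_⟩
  obtain ⟨x, rfl⟩ := hf y
  have hle : LieSubalgebra.lieSpan k L s ≤ (LieSubalgebra.lieSpan k L' (f '' s)).comap f :=
    LieSubalgebra.lieSpan_le.mpr fun z hz => LieSubalgebra.subset_lieSpan ⟨z, hz, rfl⟩
  have hx : x ∈ LieSubalgebra.lieSpan k L s := by rw [h]; trivial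
  exact hle hx

instance (V : Type v) [AddCommGroup V] [Module k V] [FiniteDimensional k V] :
    FinitelyGenerated k (FreeLie k V) := by
  let b := Module.finBasis k V
  let S := LieSubalgebra.lieSpan k (FreeLie k V) (Set.range fun i => FreeLie.ι k (b i))
  have hS : ∀ x, FreeLie.ι k x ∈ S := fun x => by
    rw [← b.sum_repr x, map_sum]
    refine sum_mem fun i _ => ?_
    rw [map_smul]
    exact S.smul_mem _ (LieSubalgebra.subset_lieSpan ⟨i, rfl⟩)
  let F : FreeLie k V →ₗ⁅k⁆ S := FreeLie.lift ((FreeLie.ι k).codRestrict S.toSubmodule hS)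
  have hF : S.incl.comp F = LieHom.id := FreeLie.hom_ext fun x => by
    change ((F (FreeLie.ι k x) : S) : FreeLie k V) = FreeLie.ι k x
    rw [FreeLie.lift_ι]; rfl
  refine ⟨_, Set.finite_range fun i => FreeLie.ι k (b i), eq_top_iff.mpr fun x _ => ?_⟩
  have h := LieHom.congr_fun hF x
  rw [LieHom.id_apply] at h
  rw [← h]
  exact (F x).2

/-- The lower central series of `L`, indexed so that `lcs k L 0 = L` and
`lcs k L (n + 1) = [L, lcs k L n]`. (When the lower central series is written
`Γ₁ = L ⊇ Γ₂ = [L, L] ⊇ ⋯`, this is `lcs k L n = Γ_{n + 1}`.) -/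
abbrev lcs (n : ℕ) : LieIdeal k L := LieModule.lowerCentralSeries k L L n

variable {k L} in
theorem map_mem_lcs {L' : Type w} [LieRing L'] [LieAlgebra k L'] (f : L →ₗ⁅k⁆ L') (n : ℕ) :
    ∀ x ∈ lcs k L n, f x ∈ lcs k L' n := fun _ hx =>
  LieIdeal.map_lowerCentralSeries_le n (f := f) (LieIdeal.mem_map hx)

theorem exists_finite_sup_lcs [FinitelyGenerated k L] (n : ℕ) :
    ∃ G : Submodule k L, FiniteDimensional k G ∧
      (lcs k L n).toSubmodule ≤ G ⊔ (lcs k L (n + 1)).toSubmodule := by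
  obtain ⟨s, hs, hspan⟩ := FinitelyGenerated.exists_lieSpan (k := k) (L := L)
  have hlie : ∀ (n : ℕ) (x y : L), y ∈ lcs k L n → ⁅x, y⁆ ∈ lcs k L (n + 1) := fun n x y hy => by
    rw [lcs, LieModule.lowerCentralSeries_succ]
    exact LieSubmodule.lie_mem_lie (LieSubmodule.mem_top x) hy
  have h0 : ∀ x : L, x ∈ Submodule.span k s ⊔ (lcs k L 1).toSubmodule := by
    let T : LieSubalgebra k L :=
      { Submodule.span k s ⊔ (lcs k L 1).toSubmodule with
        lie_mem' := fun {x y} _ _ =>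
          Submodule.mem_sup_right (hlie 0 x y (by simp)) }
    have hT : LieSubalgebra.lieSpan k L s ≤ T :=
      LieSubalgebra.lieSpan_le.mpr fun x hx =>
        (Submodule.mem_sup_left (Submodule.subset_span hx) :
          x ∈ Submodule.span k s ⊔ (lcs k L 1).toSubmodule)
    intro x
    have hx : x ∈ LieSubalgebra.lieSpan k L s := by rw [hspan]; trivial
    exact hT hx
  have hfs : FiniteDimensional k (Submodule.span k s) := FiniteDimensional.span_of_finite k hs
  induction n with
  | zero => exact ⟨Submodule.span k s, hfs, fun x _ => h0 x⟩
  | succ n ih =>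
    obtain ⟨G, hG, hle⟩ := ih
    refine ⟨Submodule.map₂ (LieModule.toEnd k L L : L →ₗ[k] L →ₗ[k] L) (Submodule.span k s) G,
      ?_, ?_⟩
    · exact Module.Finite.iff_fg.mpr (Submodule.FG.map₂ _ (Module.Finite.iff_fg.mp hfs)
        (Module.Finite.iff_fg.mp hG))
    · have hlie1 : ∀ (x y : L), x ∈ lcs k L 1 → y ∈ lcs k L n → ⁅x, y⁆ ∈ lcs k L (n + 2) := by
        intro x y hx hy
        rw [lcs, LieModule.lowerCentralSeries_succ, ← LieSubmodule.mem_toSubmodule,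
          LieSubmodule.lieIdeal_oper_eq_linear_span'] at hx
        induction hx using Submodule.span_induction with
        | mem x hx =>
          obtain ⟨a, -, c, -, rfl⟩ := hx
          rw [lie_lie]
          exact sub_mem (hlie _ _ _ (hlie _ _ _ hy)) (hlie _ _ _ (hlie _ _ _ hy))
        | zero => rw [zero_lie]; exact zero_mem _
        | add x z _ _ hx hz => rw [add_lie]; exact add_mem hx hz
        | smul c x _ hx => rw [smul_lie]; exact (lcs k L (n + 2)).smul_mem c hx
      intro z hz
      rw [LieSubmodule.mem_toSubmodule, lcs, LieModule.lowerCentralSeries_succ,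
        ← LieSubmodule.mem_toSubmodule, LieSubmodule.lieIdeal_oper_eq_linear_span'] at hz
      refine (Submodule.span_le.mpr ?_ : Submodule.span k _ ≤ _) hz
      rintro _ ⟨x, -, y, hy, rfl⟩
      obtain ⟨w, hw, x', hx', rfl⟩ := Submodule.mem_sup.mp (h0 x)
      obtain ⟨g, hg, y', hy', rfl⟩ := Submodule.mem_sup.mp (hle hy)
      have hg' : g ∈ lcs k L n := by
        have h : g + y' - y' ∈ lcs k L n :=
          sub_mem hy (LieModule.antitone_lowerCentralSeries k L L n.le_succ hy')
        simpa using h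
      rw [lie_add, add_lie, add_assoc ⁅w, g⁆]
      exact Submodule.add_mem_sup (Submodule.apply_mem_map₂ _ hw hg)
        (add_mem (hlie1 _ _ hx' hg') (hlie (n + 1) _ _ hy'))

/-- For a finitely generated Lie algebra `L`, the quotients of `L` by the terms of the lower central
series are finite-dimensional. -/
instance finiteDimensional_quot_lcs [FinitelyGenerated k L] (n : ℕ) :
    FiniteDimensional k (L ⧸ lcs k L n) := by
  have h : ∃ G : Submodule k L, FiniteDimensional k G ∧ ⊤ ≤ G ⊔ (lcs k L n).toSubmodule := by
    induction n with
    | zero => exact ⟨⊥, inferInstance, by simp⟩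
    | succ n ih =>
      obtain ⟨G, hG, hle⟩ := ih
      obtain ⟨G', hG', hle'⟩ := exists_finite_sup_lcs k L n
      refine ⟨G ⊔ G', inferInstance, hle.trans ?_⟩
      rw [sup_assoc]
      exact sup_le_sup_left hle' G
  obtain ⟨G, hG, hle⟩ := h
  refine Module.Finite.of_surjective ((lcs k L n).toSubmodule.mkQ ∘ₗ G.subtype) fun x => ?_
  obtain ⟨x, rfl⟩ := quotMk_surjective _ x
  obtain ⟨g, hg, y, hy, rfl⟩ := Submodule.mem_sup.mp (hle (Submodule.mem_top : x ∈ ⊤))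
  refine ⟨⟨g, hg⟩, ?_⟩
  rw [map_add, quotMk_eq_zero.mpr hy, add_zero]
  rfl

end finite

end LieAlgebra
end

noncomputable section

namespace CDGA

variable {k : Type u} [Field k]

/-! ### The functor `Ĉ` -/

section completedCochains

variable [CharZero k]

section object

variable (k) (L : Type v) [LieRing L] [LieAlgebra k L] [LieAlgebra.FinitelyGenerated k L]

open LieAlgebra in
/-- The projection `L / Γ_{j+1} → L / Γ_{i+1}` for `i ≤ j`. -/
def lcsProj (i j : ℕ) (h : i ≤ j) : L ⧸ lcs k L j →ₗ⁅k⁆ L ⧸ lcs k L i :=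
  quotMap (lcs k L j) (lcs k L i) LieHom.id fun _ hx =>
    LieModule.antitone_lowerCentralSeries k L L h hx

/-- The sequence of cdgas `C(L / Γ₁) → C(L / Γ₂) → ⋯` defined by the canonical projections between
the quotients of `L` by the terms of its lower central series. -/
def cochainsTower : Tower.{u, max u v} k where
  obj n := cochains k (L ⧸ LieAlgebra.lcs k L n)
  map i j h := cochainsMap (lcsProj k L i j h)
  map_id i := by
    rw [← cochainsMap_id]
    congr 1
    exact LieAlgebra.quot_hom_ext fun x => rfl
  map_comp i j l hij hjl := by
    rw [cochainsMap_comp]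
    congr 1
    exact LieAlgebra.quot_hom_ext fun x => rfl

/-- The cdga `Ĉ(L) = lim_n C(L / Γ_n)` (inductive limit) of a finitely generated Lie algebra. -/
def completedCochains : CDGA.{u, max u v} k := (cochainsTower k L).lim

end object

section morphism

variable {L : Type v} [LieRing L] [LieAlgebra k L] [LieAlgebra.FinitelyGenerated k L]
variable {L' : Type w} [LieRing L'] [LieAlgebra k L'] [LieAlgebra.FinitelyGenerated k L']

open LieAlgebra in
/-- The map `L / Γ_{n+1} → L' / Γ_{n+1}` induced by a Lie algebra map `L → L'`. -/
def lcsMap (φ : L →ₗ⁅k⁆ L') (n : ℕ) : L ⧸ lcs k L n →ₗ⁅k⁆ L' ⧸ lcs k L' n :=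
  quotMap (lcs k L n) (lcs k L' n) φ (map_mem_lcs φ n)

/-- The functoriality of `Ĉ`: the map `Ĉ(L') → Ĉ(L)` induced by a Lie algebra map `L → L'`. -/
def completedCochainsMap (φ : L →ₗ⁅k⁆ L') :
    Hom (completedCochains k L') (completedCochains k L) :=
  (cochainsTower k L').lift
    (fun n => ((cochainsTower k L).toLim n).comp (cochainsMap (lcsMap φ n)))
    fun i j h => by
      have h1 : (cochainsMap (lcsMap φ j)).comp (cochainsMap (lcsProj k L' i j h)) =
          ((cochainsTower k L).map i j h).comp (cochainsMap (lcsMap φ i)) := by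
        refine (cochainsMap_comp _ _).trans (Eq.trans ?_ (cochainsMap_comp _ _).symm)
        congr 1
        exact LieAlgebra.quot_hom_ext fun x => rfl
      refine Hom.ext (AlgHom.ext fun a => ?_)
      refine (congrArg ((cochainsTower k L).toLim j).toAlgHom
        (DFunLike.congr_fun (congrArg Hom.toAlgHom h1) a)).trans ?_
      exact (cochainsTower k L).toLimAlg_map i j h _

end morphism

end completedCochains

/-! ### The holonomy Lie algebra -/

section holonomy

section lowDegrees

variable (A : CDGA.{u, v} k)

/-- The multiplication `A¹ ⊗ A¹ → A²`. -/
def mulOne : A.deg 1 ⊗[k] A.deg 1 →ₗ[k] A.deg 2 :=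
  TensorProduct.lift (LinearMap.mk₂ k
    (fun a b => (⟨a * b, SetLike.GradedMul.mul_mem a.2 b.2⟩ : A.deg 2))
    (fun _ _ _ => Subtype.ext (add_mul _ _ _)) (fun _ _ _ => Subtype.ext (smul_mul_assoc _ _ _))
    (fun _ _ _ => Subtype.ext (mul_add _ _ _)) (fun _ _ _ => Subtype.ext (mul_smul_comm _ _ _)))

@[simp]
theorem coe_mulOne_tmul (a b : A.deg 1) : (A.mulOne (a ⊗ₜ b) : A.carrier) = a * b := rfl

/-- The differential `A¹ → A²`. -/
def dOne : A.deg 1 →ₗ[k] A.deg 2 := A.d.restrict fun _ ha => A.d_mem ha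

@[simp]
theorem coe_dOne (a : A.deg 1) : (A.dOne a : A.carrier) = A.d a := rfl

variable {A} {B : CDGA.{u, w} k}

/-- The map `Aⁱ → Bⁱ` given by a cdga map. -/
def Hom.degMap (f : Hom A B) (i : ℕ) : A.deg i →ₗ[k] B.deg i :=
  f.toAlgHom.toLinearMap.restrict fun _ ha => f.map_deg ha

end lowDegrees

instance (A : CDGA.{u, v} k) [A.IsFinite 1] : FiniteDimensional k (A.deg 1) :=
  IsFinite.finite_deg 1 le_rfl

section object

variable (A : CDGA.{u, v} k) [A.IsFinite 1]

/-- The map `∂_A = d* + μ* : A₂ → 𝕃(A₁)`, where `Aᵢ = Hom(Aⁱ, k)`, `d*` is the dual of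
`d : A¹ → A²`, and `μ* : A₂ → A₁ ∧ A₁` is the dual of the multiplication `μ : A¹ ∧ A¹ → A²`. The
space `A₁ ∧ A₁` is identified with `𝕃₂(A₁)` by `x ∧ y ↦ [x, y]`; as `x ∧ y` is the antisymmetric
tensor `x ⊗ y - y ⊗ x`, the bracket of tensors is here multiplied by `1/2`. -/
def holonomyRelation : Module.Dual k (A.deg 2) →ₗ[k] LieAlgebra.FreeLie k (Module.Dual k (A.deg 1)) :=
  LieAlgebra.FreeLie.ι k ∘ₗ A.dOne.dualMap +
    (1 / 2 : k) • (LieAlgebra.bracketMap k _ ∘ₗ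
      TensorProduct.map (LieAlgebra.FreeLie.ι k) (LieAlgebra.FreeLie.ι k) ∘ₗ
        dualTensor ∘ₗ A.mulOne.dualMap)

/-- The ideal of `𝕃(A₁)` generated by the image of `∂_A`. -/
def holonomyIdeal : LieIdeal k (LieAlgebra.FreeLie k (Module.Dual k (A.deg 1))) :=
  LieSubmodule.lieSpan k _ (Set.range A.holonomyRelation)

/-- The holonomy Lie algebra `h(A) = 𝕃(A₁) / (im ∂_A)` of a `1`-finite cdga. -/
abbrev Holonomy : Type (max u v) :=
  LieAlgebra.FreeLie k (Module.Dual k (A.deg 1)) ⧸ A.holonomyIdeal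

instance : LieAlgebra.FinitelyGenerated k A.Holonomy :=
  .of_surjective _ (LieAlgebra.quotMk_surjective A.holonomyIdeal)

/-- The canonical map `A₁ → h(A)`. -/
def holonomyι : Module.Dual k (A.deg 1) →ₗ[k] A.Holonomy :=
  (LieAlgebra.quotMk A.holonomyIdeal : _ →ₗ[k] A.Holonomy) ∘ₗ LieAlgebra.FreeLie.ι k

theorem holonomy_relation (y : Module.Dual k (A.deg 2)) :
    A.holonomyι (A.dOne.dualMap y) + (1 / 2 : k) • LieAlgebra.bracketMap k A.Holonomy
      (TensorProduct.map A.holonomyι A.holonomyι (dualTensor (A.mulOne.dualMap y))) = 0 := by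
  have h : LieAlgebra.quotMk A.holonomyIdeal (A.holonomyRelation y) = 0 :=
    LieAlgebra.quotMk_eq_zero.mpr (LieSubmodule.subset_lieSpan ⟨y, rfl⟩)
  rw [← h, holonomyRelation, LinearMap.add_apply, map_add, LinearMap.smul_apply, map_smul]
  refine congrArg₂ (· + ·) rfl (congrArg ((1 / 2 : k) • ·) ?_)
  simp only [LinearMap.comp_apply]
  generalize dualTensor (A.mulOne.dualMap y) = t
  induction t with
  | zero => simp
  | add x y hx hy => simp only [map_add, hx, hy]
  | tmul x y => rfl

end object

section morphism

variable {A : CDGA.{u, v₁} k} {B : CDGA.{u, v₂} k} [A.IsFinite 1] [B.IsFinite 1]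

theorem lift_holonomyRelation (f : Hom A B) (y : Module.Dual k (B.deg 2)) :
    LieAlgebra.FreeLie.lift (LieAlgebra.FreeLie.ι k ∘ₗ (f.degMap 1).dualMap)
      (B.holonomyRelation y) = A.holonomyRelation ((f.degMap 2).dualMap y) := by
  have hd : A.dOne.dualMap ((f.degMap 2).dualMap y) =
      (f.degMap 1).dualMap (B.dOne.dualMap y) := by
    refine LinearMap.ext fun a => congrArg y (Subtype.ext ?_)
    exact f.map_d a
  have hm : A.mulOne.dualMap ((f.degMap 2).dualMap y) =
      (TensorProduct.map (f.degMap 1) (f.degMap 1)).dualMap (B.mulOne.dualMap y) := by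
    refine TensorProduct.ext' fun a b => congrArg y (Subtype.ext ?_)
    exact map_mul f.toAlgHom _ _
  simp only [holonomyRelation, LinearMap.add_apply, LinearMap.smul_apply, LinearMap.comp_apply,
    map_add, map_smul, hd, hm, dualTensor_natural, LieAlgebra.FreeLie.lift_ι]
  congr 2
  generalize dualTensor (B.mulOne.dualMap y) = t
  induction t with
  | zero => simp
  | add x y hx hy => simp only [map_add, hx, hy]
  | tmul x y => simp [LieAlgebra.FreeLie.lift_ι]

/-- The functoriality of the holonomy Lie algebra: a cdga map `A → B` induces `h(B) → h(A)`, the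
extension of the dual map `B₁ → A₁`. -/
def holonomyMap (f : Hom A B) : B.Holonomy →ₗ⁅k⁆ A.Holonomy :=
  LieAlgebra.quotMap B.holonomyIdeal A.holonomyIdeal
    (LieAlgebra.FreeLie.lift (LieAlgebra.FreeLie.ι k ∘ₗ (f.degMap 1).dualMap)) fun x hx => by
      have h : B.holonomyIdeal ≤ A.holonomyIdeal.comap
          (LieAlgebra.FreeLie.lift (LieAlgebra.FreeLie.ι k ∘ₗ (f.degMap 1).dualMap)) := by
        refine LieSubmodule.lieSpan_le.mpr ?_
        rintro _ ⟨y, rfl⟩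
        refine LieIdeal.mem_comap.mpr ?_
        rw [lift_holonomyRelation]
        exact LieSubmodule.subset_lieSpan ⟨_, rfl⟩
      exact LieIdeal.mem_comap.mp (h hx)

end morphism

end holonomy

end CDGA
end

noncomputable section

namespace CDGA

variable {k : Type u} [Field k]

/-! ### Flat connections and the classifying map -/

section flat

variable (A : CDGA.{u, v} k) (g : Type w) [LieRing g] [LieAlgebra k g]

/-- The bracket `[a ⊗ x, b ⊗ y] = ab ⊗ [x, y]` of two elements of `A¹ ⊗ g`, in `A² ⊗ g`. -/
def connectionBracket (ω ω' : A.deg 1 ⊗[k] g) : A.deg 2 ⊗[k] g :=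
  TensorProduct.map A.mulOne (LieAlgebra.bracketMap k g)
    (TensorProduct.tensorTensorTensorComm k (A.deg 1) g (A.deg 1) g (ω ⊗ₜ ω'))

theorem connectionBracket_sum {ι : Type*} [Fintype ι]
    (a : ι → A.deg 1) (x : ι → g) :
    A.connectionBracket g (∑ i, a i ⊗ₜ x i) (∑ i, a i ⊗ₜ x i) =
      ∑ i, ∑ j, A.mulOne (a i ⊗ₜ a j) ⊗ₜ ⁅x i, x j⁆ := by
  rw [connectionBracket, TensorProduct.sum_tmul]
  simp only [TensorProduct.tmul_sum, map_sum, TensorProduct.tensorTensorTensorComm_tmul,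
    TensorProduct.map_tmul, LieAlgebra.bracketMap_tmul]

/-- The set `F(A, g)` of `g`-valued flat connections on `A`: the elements `ω ∈ A¹ ⊗ g` which satisfy
the Maurer–Cartan equation `dω + (1/2) [ω, ω] = 0`. -/
def FlatConnection : Type (max v w) :=
  {ω : A.deg 1 ⊗[k] g // A.dOne.rTensor g ω + (1 / 2 : k) • A.connectionBracket g ω ω = 0}

variable {A g}

/-- The covariant functoriality of `F(A, g)` in `g`. -/
def FlatConnection.map {g' : Type v₁} [LieRing g'] [LieAlgebra k g'] (φ : g →ₗ⁅k⁆ g')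
    (ω : A.FlatConnection g) : A.FlatConnection g' :=
  ⟨(φ : g →ₗ[k] g').lTensor (A.deg 1) ω.1, by
    have hd : ∀ z : A.deg 1 ⊗[k] g, A.dOne.rTensor g' ((φ : g →ₗ[k] g').lTensor (A.deg 1) z) =
        (φ : g →ₗ[k] g').lTensor (A.deg 2) (A.dOne.rTensor g z) := fun z => by
      induction z with
      | zero => simp
      | add x y hx hy => simp only [map_add, hx, hy]
      | tmul x y => rfl
    have hb : ∀ z z' : A.deg 1 ⊗[k] g, A.connectionBracket g'
          ((φ : g →ₗ[k] g').lTensor (A.deg 1) z) ((φ : g →ₗ[k] g').lTensor (A.deg 1) z') =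
        (φ : g →ₗ[k] g').lTensor (A.deg 2) (A.connectionBracket g z z') := fun z z' => by
      simp only [connectionBracket]
      induction z with
      | zero => simp
      | add x y hx hy => simp only [map_add, TensorProduct.add_tmul, hx, hy]
      | tmul a x =>
        induction z' with
        | zero => simp
        | add x y hx hy => simp only [map_add, TensorProduct.tmul_add, hx, hy]
        | tmul b y => simp
    rw [hd, hb, ← map_smul, ← map_add, ω.2, map_zero]⟩

/-- The pairing `A¹ ⊗ g → A¹`, `a ⊗ x ↦ ξ(x) a`, with an element `ω` of `A¹ ⊗ g`, as a linear map
`g* → A¹` in `ξ`. -/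
def pairing (ω : A.deg 1 ⊗[k] g) : Module.Dual k g →ₗ[k] A.deg 1 :=
  (TensorProduct.rid k (A.deg 1)).toLinearMap ∘ₗ (LinearMap.lTensorHom (A.deg 1)).flip ω

theorem pairing_tmul (a : A.deg 1) (x : g) (ξ : Module.Dual k g) :
    pairing (a ⊗ₜ[k] x) ξ = ξ x • a := rfl

theorem pairing_add (ω ω' : A.deg 1 ⊗[k] g) : pairing (ω + ω') = pairing ω + pairing ω' := by
  refine LinearMap.ext fun ξ => ?_
  simp [pairing]

theorem pairing_zero : pairing (0 : A.deg 1 ⊗[k] g) = 0 := by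
  refine LinearMap.ext fun ξ => ?_
  simp [pairing]

theorem dOne_pairing (ω : A.deg 1 ⊗[k] g) (ξ : Module.Dual k g) :
    A.dOne (pairing ω ξ) =
      TensorProduct.rid k (A.deg 2) (ξ.lTensor (A.deg 2) (A.dOne.rTensor g ω)) := by
  induction ω with
  | zero => simp [pairing_zero]
  | add x y hx hy => simp only [pairing_add, LinearMap.add_apply, map_add, hx, hy]
  | tmul a x => rw [pairing_tmul, map_smul]; rfl

theorem mulOne_pairing [FiniteDimensional k g] (ω ω' : A.deg 1 ⊗[k] g)
    (t : Module.Dual k g ⊗[k] Module.Dual k g) :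
    A.mulOne (TensorProduct.map (pairing ω) (pairing ω') t) =
      TensorProduct.rid k (A.deg 2) (TensorProduct.map A.mulOne (TensorProduct.dualDistrib k g g t)
        (TensorProduct.tensorTensorTensorComm k (A.deg 1) g (A.deg 1) g (ω ⊗ₜ ω'))) := by
  induction t with
  | zero => simp
  | add x y hx hy => simp only [map_add, hx, hy, TensorProduct.map_add_right, LinearMap.add_apply]
  | tmul ξ η =>
    rw [TensorProduct.map_tmul]
    induction ω with
    | zero => simp [pairing_zero]
    | add x y hx hy =>
      simp only [pairing_add, LinearMap.add_apply, map_add, TensorProduct.add_tmul, hx, hy]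
    | tmul a x =>
      induction ω' with
      | zero => simp [pairing_zero]
      | add x y hx hy =>
        simp only [pairing_add, LinearMap.add_apply, map_add, TensorProduct.tmul_add, hx, hy]
      | tmul b y =>
        rw [pairing_tmul, pairing_tmul, TensorProduct.smul_tmul_smul, map_smul]
        simp

theorem mulOne_pairing_bracket [FiniteDimensional k g] (ω : A.FlatConnection g)
    (ξ : Module.Dual k g) :
    -((1 / 2 : k) • A.mulOne (TensorProduct.map (pairing ω.1) (pairing ω.1)
      (dualTensor ((LieAlgebra.bracketMap k g).dualMap ξ)))) = A.dOne (pairing ω.1 ξ) := by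
  have h := congrArg (fun z => TensorProduct.rid k (A.deg 2) (ξ.lTensor (A.deg 2) z)) ω.2
  simp only [map_add, map_smul, map_zero, ← dOne_pairing] at h
  rw [mulOne_pairing, dualDistrib_dualTensor]
  rw [eq_comm, eq_neg_iff_add_eq_zero, ← h]
  congr 3
  simp only [connectionBracket]
  generalize TensorProduct.tensorTensorTensorComm k (A.deg 1) g (A.deg 1) g (ω.1 ⊗ₜ ω.1) = z
  induction z with
  | zero => simp
  | add x y hx hy => simp only [map_add, hx, hy]
  | tmul a x => rfl

theorem sq_zero_of_mem_deg_one [CharZero k] {a : A.carrier} (ha : a ∈ A.deg 1) : a * a = 0 := by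
  have h : a * a = -(a * a) := by simpa using A.mul_comm ha ha
  have h2 : (2 : k) • (a * a) = 0 := by
    rw [two_smul]
    nth_rw 1 [h]
    exact neg_add_cancel _
  exact (smul_eq_zero.mp h2).resolve_left two_ne_zero

section classify

variable [CharZero k]

/-- The map of algebras `⋀ g* → A` which extends the linear map `g* → A¹` given by an element of
`A¹ ⊗ g`. -/
def pairingAlgHom (ω : A.deg 1 ⊗[k] g) : ExteriorAlgebra k (Module.Dual k g) →ₐ[k] A.carrier :=
  ExteriorAlgebra.lift k ⟨(A.deg 1).subtype ∘ₗ pairing ω, fun ξ =>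
    sq_zero_of_mem_deg_one (pairing ω ξ).2⟩

theorem pairingAlgHom_ι (ω : A.deg 1 ⊗[k] g) (ξ : Module.Dual k g) :
    pairingAlgHom ω (ExteriorAlgebra.ι k ξ) = pairing ω ξ :=
  ExteriorAlgebra.lift_ι_apply _ _ _ _

variable [FiniteDimensional k g]

theorem pairingAlgHom_gen (ω : A.FlatConnection g) (ξ : Module.Dual k g) :
    pairingAlgHom ω.1 (LieAlgebra.cochainDifferentialGen k g ξ) =
      A.d (pairingAlgHom ω.1 (ExteriorAlgebra.ι k ξ)) := by
  rw [pairingAlgHom_ι, ← coe_dOne, ← mulOne_pairing_bracket]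
  simp only [LieAlgebra.cochainDifferentialGen, LinearMap.neg_apply, LinearMap.smul_apply,
    LinearMap.comp_apply, map_neg, map_smul, Submodule.coe_neg, Submodule.coe_smul]
  congr 2
  generalize dualTensor ((LieAlgebra.bracketMap k g).dualMap ξ) = t
  induction t with
  | zero => simp
  | add x y hx hy => simp only [map_add, Submodule.coe_add, hx, hy]
  | tmul x y => simp [pairingAlgHom_ι]

/-- The cdga map `C(g) → A` corresponding to a flat connection `ω ∈ A¹ ⊗ g`. On the generators, it
is the map `g* → A¹` corresponding to `ω` under `A¹ ⊗ g ≅ Hom(g*, A¹)`. -/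
def FlatConnection.toHom (ω : A.FlatConnection g) : Hom (cochains k g) A where
  toAlgHom := pairingAlgHom ω.1
  map_deg ha := exterior_map_deg (B := A) _ (fun ξ => by
    rw [pairingAlgHom_ι]; exact (pairing ω.1 ξ).2) ha
  map_d a := exterior_map_d (B := A) _ (fun ξ => by
    rw [pairingAlgHom_ι]; exact (pairing ω.1 ξ).2) _ (LieAlgebra.cochainDifferentialGen_mem k g)
      (pairingAlgHom_gen ω) a

theorem FlatConnection.toHom_comp_cochainsMap {g' : Type v₁} [LieRing g'] [LieAlgebra k g']
    [FiniteDimensional k g'] (φ : g →ₗ⁅k⁆ g') (ω : A.FlatConnection g) :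
    ω.toHom.comp (cochainsMap φ) = (ω.map φ).toHom := by
  have h : (pairingAlgHom ω.1).comp (ExteriorAlgebra.map (φ : g →ₗ[k] g').dualMap) =
      pairingAlgHom (ω.map φ).1 := by
    refine ExteriorAlgebra.hom_ext (LinearMap.ext fun ξ => ?_)
    change pairingAlgHom ω.1 (ExteriorAlgebra.map _ (ExteriorAlgebra.ι k ξ)) =
      pairingAlgHom _ (ExteriorAlgebra.ι k ξ)
    rw [ExteriorAlgebra.map_apply_ι, pairingAlgHom_ι, pairingAlgHom_ι]
    refine congrArg Subtype.val ?_
    change pairing ω.1 _ = pairing ((φ : g →ₗ[k] g').lTensor (A.deg 1) ω.1) ξ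
    generalize ω.1 = z
    induction z with
    | zero => simp [pairing_zero]
    | add x y hx hy => simp only [pairing_add, LinearMap.add_apply, map_add, hx, hy]
    | tmul a x => rfl
  exact Hom.ext h

end classify

end flat

section classifyingMap

variable (A : CDGA.{u, v} k) [A.IsFinite 1]

theorem eq_zero_of_forall_dual {V : Type v₁} [AddCommGroup V] [Module k V] {W : Type v₂}
    [AddCommGroup W] [Module k W] (z : V ⊗[k] W)
    (h : ∀ y : Module.Dual k V, TensorProduct.lid k W (y.rTensor W z) = 0) : z = 0 := by
  classical
  let b := Module.Basis.ofVectorSpace k V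
  have hz : TensorProduct.equivFinsuppOfBasisLeft b z = 0 := by
    refine Finsupp.ext fun i => ?_
    rw [TensorProduct.equivFinsuppOfBasisLeft_apply]
    simpa using h (b.coord i)
  simpa using hz

/-- The canonical element `∑ᵢ xᵢ* ⊗ xᵢ ∈ A¹ ⊗ h(A)`, where `{xᵢ}` is a basis of `A₁` and `{xᵢ*}` is
the dual basis of `A¹`. -/
def canonicalElement : A.deg 1 ⊗[k] A.Holonomy :=
  A.holonomyι.lTensor (A.deg 1) (coevaluation k (A.deg 1) 1)

theorem canonicalElement_eq_sum : A.canonicalElement =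
    ∑ i, Module.Basis.ofVectorSpace k (A.deg 1) i ⊗ₜ[k]
      A.holonomyι ((Module.Basis.ofVectorSpace k (A.deg 1)).coord i) := by
  rw [canonicalElement, coevaluation_apply_one, map_sum]
  rfl

theorem canonicalElement_flat : A.dOne.rTensor A.Holonomy A.canonicalElement +
    (1 / 2 : k) • A.connectionBracket A.Holonomy A.canonicalElement A.canonicalElement = 0 := by
  classical
  rw [canonicalElement_eq_sum]
  generalize Module.Basis.ofVectorSpace k (A.deg 1) = b
  refine eq_zero_of_forall_dual _ fun y => ?_
  have h1 : A.dOne.dualMap y = ∑ i, y (A.dOne (b i)) • b.coord i := by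
    refine b.ext fun l => ?_
    simp [Finsupp.single_apply]
  rw [← A.holonomy_relation y, dualTensor_eq_sum b, h1, connectionBracket_sum]
  simp only [map_add, map_smul, map_sum, LinearMap.rTensor_tmul, TensorProduct.lid_tmul,
    TensorProduct.map_tmul, LieAlgebra.bracketMap_tmul, LinearMap.dualMap_apply]

/-- The canonical flat connection `ω = ∑ᵢ xᵢ* ⊗ xᵢ ∈ F(A, h(A))`. -/
def canonicalConnection : A.FlatConnection A.Holonomy :=
  ⟨A.canonicalElement, A.canonicalElement_flat⟩

variable [CharZero k]

/-- The cdga map `f_n : C(h(A) / Γ_{n+1}) → A` corresponding to the image of the canonical flat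
connection in `F(A, h(A) / Γ_{n+1})`. -/
def classifyingMapAt (n : ℕ) : Hom (cochains k (A.Holonomy ⧸ LieAlgebra.lcs k A.Holonomy n)) A :=
  (A.canonicalConnection.map (LieAlgebra.quotMk (LieAlgebra.lcs k A.Holonomy n))).toHom

theorem classifyingMapAt_comp (i j : ℕ) (h : i ≤ j) :
    (A.classifyingMapAt j).comp ((cochainsTower k A.Holonomy).map i j h) =
      A.classifyingMapAt i := by
  refine (FlatConnection.toHom_comp_cochainsMap (lcsProj k A.Holonomy i j h) _).trans ?_
  refine congrArg FlatConnection.toHom (Subtype.ext ?_)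
  exact (LinearMap.lTensor_comp_apply (A.deg 1) _ _ _).symm

/-- The classifying map `f : Ĉ(h(A)) → A`, the limit of the maps `f_n : C(h(A) / Γ_n) → A`. -/
def classifyingMap : Hom (completedCochains k A.Holonomy) A :=
  (cochainsTower k A.Holonomy).lift A.classifyingMapAt A.classifyingMapAt_comp

end classifyingMap

end CDGA
end

/-!
The classifying map `f : Ĉ(h(A)) → A` is determined by its restrictions to the generators, the
linear forms on the quotients `h(A) / Γ_{n+1}`, and there it is the transpose of the canonical map
`A₁ → h(A)` (`CDGA.apply_pairing_canonicalConnection`). Functoriality and naturality are therefore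
checked on generators.

The algebra `Ĉ(L)` is free on the union `V` of the images of the spaces `(L / Γ_{n+1})*`, as exterior
algebras commute with inductive limits, and these images filter `V`. As `L / Γ_{n+2}` is a central
extension of `L / Γ_{n+1}`, its bracket factors through `L / Γ_{n+1}`, so that the differential moves
each step of the filtration into the exterior algebra on the previous one
(`CDGA.exists_map_eq_cochainDifferentialGen`).

That `f` is a `1`-equivalence rests on one construction, `CDGA.exists_primitive`. Let `c` be a
`2`-cocycle on `g = h(A) / Γ_{n+1}` with `f(c) = da` for some `a ∈ A¹`. The cocycle `-c` defines a
central extension `E` of `g` by `k`. The linear map `A₁ → E` with coordinates `A₁ → g` and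
evaluation at `a` satisfies the holonomy relations, exactly because `f(c) = da`, and so it extends to
a Lie algebra map `h(A) → E` over `g`. Its coordinate `ξ` in `k` satisfies `ξ([u, v]) = -c(u, v)`.
Hence `ξ` vanishes on `Γ_{n+2}`, and `dξ` is the pullback of `c` to `h(A) / Γ_{n+2}`. This gives the
injectivity of `H²(f)`, and with `c = 0` the surjectivity of `H¹(f)`. The injectivity of `H¹(f)`
holds because a closed generator is a linear form which vanishes on brackets, so that it is
determined by its values on the generators `A₁` of the Lie algebra `h(A)`.
-/

noncomputable section

/-! ### Bilinear forms and the exterior square of a dual space -/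

namespace ExteriorAlgebra

variable {k : Type u} [Field k] {V : Type v} [AddCommGroup V] [Module k V]

/-- The value on the vectors `x`, `y` of (the degree-two part of) an element of `⋀ V*`, normalized
by `(ξ ∧ η)(x, y) = ξ(x) η(y) - η(x) ξ(y)`. It is obtained by contracting twice. -/
def eval₂ (x y : V) : ExteriorAlgebra k (Module.Dual k V) →ₗ[k] k :=
  (algebraMapInv (R := k) (M := Module.Dual k V)).toLinearMap ∘ₗ
    CliffordAlgebra.contractLeft (Module.Dual.eval k V y) ∘ₗ
    CliffordAlgebra.contractLeft (Module.Dual.eval k V x)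

/-- The value on the vectors `x`, `y`, `z` of (the degree-three part of) an element of `⋀ V*`, with
`(ξ ∧ η ∧ ζ)(x, y, z)` the determinant of the nine values. -/
def eval₃ (x y z : V) : ExteriorAlgebra k (Module.Dual k V) →ₗ[k] k :=
  eval₂ y z ∘ₗ CliffordAlgebra.contractLeft (Module.Dual.eval k V x)

theorem contractLeft_ι_mul (d : Module.Dual k V) (a : V) (b : ExteriorAlgebra k V) :
    CliffordAlgebra.contractLeft d (ι k a * b) =
      d a • b - ι k a * CliffordAlgebra.contractLeft d b :=
  CliffordAlgebra.contractLeft_ι_mul _ _ _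

theorem contractLeft_ι (d : Module.Dual k V) (a : V) :
    CliffordAlgebra.contractLeft d (ι k a) = algebraMap k (ExteriorAlgebra k V) (d a) :=
  CliffordAlgebra.contractLeft_ι _ _ _

theorem eval₂_ι_mul_ι (x y : V) (ξ η : Module.Dual k V) :
    eval₂ x y (ι k ξ * ι k η) = ξ x * η y - η x * ξ y := by
  rw [eval₂, LinearMap.comp_apply, LinearMap.comp_apply, contractLeft_ι_mul, contractLeft_ι,
    ← Algebra.commutes, ← Algebra.smul_def, map_sub, map_smul, map_smul, contractLeft_ι,
    contractLeft_ι, map_sub, map_smul, map_smul, AlgHom.toLinearMap_apply, AlgHom.toLinearMap_apply,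
    algebraMap_leftInverse, algebraMap_leftInverse]
  rfl

theorem eval₂_self (x : V) (a : ExteriorAlgebra k (Module.Dual k V)) : eval₂ x x a = 0 := by
  change algebraMapInv (CliffordAlgebra.contractLeft (Q := (0 : QuadraticForm k (Module.Dual k V)))
    _ (CliffordAlgebra.contractLeft _ a)) = 0
  rw [CliffordAlgebra.contractLeft_contractLeft, map_zero]

/-- The products `ξ ∧ η` span `⋀² V`. -/
theorem exteriorPower_two_induction {P : (a : ExteriorAlgebra k V) → a ∈ ⋀[k]^2 V → Prop}
    (hmul : ∀ (x y : V) (h : ι k x * ι k y ∈ ⋀[k]^2 V), P (ι k x * ι k y) h)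
    (hadd : ∀ a ha b hb, P a ha → P b hb → P (a + b) (add_mem ha hb))
    {a : ExteriorAlgebra k V} (ha : a ∈ ⋀[k]^2 V) : P a ha := by
  suffices h : ∃ h : a ∈ ⋀[k]^2 V, P a h from h.2
  change a ∈ LinearMap.range (ι k (M := V)) ^ 2 at ha
  rw [pow_two] at ha
  induction ha using Submodule.mul_induction_on' with
  | mem_mul_mem m hm n hn =>
    obtain ⟨x, rfl⟩ := hm
    obtain ⟨y, rfl⟩ := hn
    exact ⟨SetLike.GradedMul.mul_mem (A := fun i : ℕ => ⋀[k]^i V) (ι_mem_one x) (ι_mem_one y),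
      hmul x y _⟩
  | add x _ y _ hx hy => exact ⟨_, hadd x hx.1 y hy.1 hx.2 hy.2⟩

theorem eval₃_mul_ι (x y z : V) {p : ExteriorAlgebra k (Module.Dual k V)}
    (hp : p ∈ ⋀[k]^2 (Module.Dual k V)) (ζ : Module.Dual k V) :
    eval₃ x y z (p * ι k ζ) = eval₂ x y p * ζ z + eval₂ y z p * ζ x + eval₂ z x p * ζ y := by
  induction hp using exteriorPower_two_induction with
  | hmul ξ η _ =>
    rw [eval₃, LinearMap.comp_apply, mul_assoc, contractLeft_ι_mul, contractLeft_ι_mul,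
      contractLeft_ι, ← Algebra.commutes, ← Algebra.smul_def, mul_sub, mul_smul_comm, mul_smul_comm]
    simp only [map_sub, map_smul, eval₂_ι_mul_ι, Module.Dual.eval_apply, smul_eq_mul]
    ring
  | hadd a _ b _ ha hb =>
    simp only [add_mul, map_add, ha, hb]
    ring

/-- The bilinear form on `V` given by the degree-two part of an element of `⋀ V*`. -/
def toForm (a : ExteriorAlgebra k (Module.Dual k V)) : Module.Dual k (V ⊗[k] V) :=
  TensorProduct.lift (LinearMap.mk₂ k (fun x y => eval₂ x y a)
    (fun _ _ _ => by simp [eval₂]) (fun _ _ _ => by simp [eval₂])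
    (fun _ _ _ => by simp [eval₂]) (fun _ _ _ => by simp [eval₂]))

theorem toForm_tmul (a : ExteriorAlgebra k (Module.Dual k V)) (x y : V) :
    toForm a (x ⊗ₜ y) = eval₂ x y a := rfl

variable [FiniteDimensional k V]

/-- The image of a bilinear form under `(V ⊗ V)* ≅ V* ⊗ V* → ⋀² V*`. On alternating forms it is
twice the inverse of `toForm`. -/
def ofForm : Module.Dual k (V ⊗[k] V) →ₗ[k] ExteriorAlgebra k (Module.Dual k V) :=
  LinearMap.mul' k (ExteriorAlgebra k (Module.Dual k V)) ∘ₗ TensorProduct.map (ι k) (ι k) ∘ₗ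
    dualTensor

theorem ofForm_dualDistrib_tmul (ξ η : Module.Dual k V) :
    ofForm (TensorProduct.dualDistrib k V V (ξ ⊗ₜ η)) = ι k ξ * ι k η := by
  rw [ofForm, LinearMap.comp_apply, LinearMap.comp_apply, dualTensor_dualDistrib,
    TensorProduct.map_tmul, LinearMap.mul'_apply]

/-- Every bilinear form is a sum of products of linear forms. -/
theorem form_induction {P : Module.Dual k (V ⊗[k] V) → Prop} (h0 : P 0)
    (hmul : ∀ ξ η : Module.Dual k V, P (TensorProduct.dualDistrib k V V (ξ ⊗ₜ η)))
    (hadd : ∀ B C, P B → P C → P (B + C)) (B : Module.Dual k (V ⊗[k] V)) : P B := by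
  rw [← dualDistrib_dualTensor B]
  generalize dualTensor B = t
  induction t with
  | zero => rwa [map_zero]
  | add x y hx hy => rw [map_add]; exact hadd _ _ hx hy
  | tmul x y => exact hmul x y

theorem eval₂_ofForm (x y : V) (B : Module.Dual k (V ⊗[k] V)) :
    eval₂ x y (ofForm B) = B (x ⊗ₜ y) - B (y ⊗ₜ x) := by
  induction B using form_induction with
  | h0 => simp
  | hmul ξ η =>
    rw [ofForm_dualDistrib_tmul, eval₂_ι_mul_ι, TensorProduct.dualDistrib_apply,
      TensorProduct.dualDistrib_apply]
    ring
  | hadd B C hB hC =>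
    rw [map_add, map_add, hB, hC, LinearMap.add_apply, LinearMap.add_apply]
    ring

theorem ofForm_toForm {a : ExteriorAlgebra k (Module.Dual k V)}
    (ha : a ∈ ⋀[k]^2 (Module.Dual k V)) : ofForm (toForm a) = (2 : k) • a := by
  induction ha using exteriorPower_two_induction with
  | hmul ξ η _ =>
    have h : toForm (ι k ξ * ι k η) = TensorProduct.dualDistrib k V V (ξ ⊗ₜ η) -
        TensorProduct.dualDistrib k V V (η ⊗ₜ ξ) := by
      refine TensorProduct.ext' fun x y => ?_
      rw [toForm_tmul, eval₂_ι_mul_ι]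
      rfl
    rw [h, map_sub, ofForm_dualDistrib_tmul, ofForm_dualDistrib_tmul, two_smul,
      eq_neg_of_add_eq_zero_left (ι_add_mul_swap η ξ), sub_neg_eq_add]
  | hadd a _ b _ ha hb =>
    have h : toForm (a + b) = toForm a + toForm b :=
      TensorProduct.ext' fun x y => map_add (eval₂ x y) a b
    rw [h, map_add, ha, hb, smul_add]

theorem map_ofForm {W : Type w} [AddCommGroup W] [Module k W] [FiniteDimensional k W]
    (φ : V →ₗ[k] W) (B : Module.Dual k (W ⊗[k] W)) :
    ExteriorAlgebra.map φ.dualMap (ofForm B) = ofForm ((TensorProduct.map φ φ).dualMap B) := by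
  induction B using form_induction with
  | h0 => simp
  | hmul ξ η =>
    have h : (TensorProduct.map φ φ).dualMap (TensorProduct.dualDistrib k W W (ξ ⊗ₜ η)) =
        TensorProduct.dualDistrib k V V (φ.dualMap ξ ⊗ₜ φ.dualMap η) :=
      TensorProduct.ext' fun x y => rfl
    rw [h, ofForm_dualDistrib_tmul, ofForm_dualDistrib_tmul, map_mul, map_apply_ι, map_apply_ι]
  | hadd B C hB hC => simp only [map_add, hB, hC]

end ExteriorAlgebra

/-! ### The Chevalley–Eilenberg differential of a `2`-cochain -/

namespace LieAlgebra

open ExteriorAlgebra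

variable {k : Type u} [Field k] {g : Type v} [LieRing g] [LieAlgebra k g] [FiniteDimensional k g]

theorem cochainDifferentialGen_eq_ofForm (ξ : Module.Dual k g) :
    cochainDifferentialGen k g ξ = -((1 / 2 : k) • ofForm ((bracketMap k g).dualMap ξ)) := rfl

variable [CharZero k]

theorem eval₂_cochainDifferentialGen (x y : g) (ξ : Module.Dual k g) :
    eval₂ x y (cochainDifferentialGen k g ξ) = -ξ ⁅x, y⁆ := by
  rw [cochainDifferentialGen_eq_ofForm, map_neg, map_smul, eval₂_ofForm, LinearMap.dualMap_apply,
    LinearMap.dualMap_apply, bracketMap_tmul, bracketMap_tmul, ← lie_skew x y, map_neg, smul_eq_mul]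
  ring

/-- The Chevalley–Eilenberg formula for the differential of a `2`-cochain. -/
theorem eval₃_cochainDifferential (x y z : g) {a : ExteriorAlgebra k (Module.Dual k g)}
    (ha : a ∈ ⋀[k]^2 (Module.Dual k g)) :
    eval₃ x y z (cochainDifferential k g a) =
      -(eval₂ ⁅x, y⁆ z a + eval₂ ⁅y, z⁆ x a + eval₂ ⁅z, x⁆ y a) := by
  induction ha using exteriorPower_two_induction with
  | hmul ξ η _ =>
    have h : cochainDifferential k g (ι k ξ * ι k η) =
        cochainDifferentialGen k g ξ * ι k η - cochainDifferentialGen k g η * ι k ξ := by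
      have h1 : ι k ξ * cochainDifferentialGen k g η = cochainDifferentialGen k g η * ι k ξ := by
        simpa using ι_mul_of_mem ξ (cochainDifferentialGen_mem k g η)
      rw [cochainDifferential, antiderivation_ι_mul, antiderivation_ι, h1]
    rw [h, map_sub, eval₃_mul_ι _ _ _ (cochainDifferentialGen_mem k g ξ),
      eval₃_mul_ι _ _ _ (cochainDifferentialGen_mem k g η)]
    simp only [eval₂_cochainDifferentialGen, eval₂_ι_mul_ι]
    ring
  | hadd a _ b _ ha hb =>
    simp only [map_add, ha, hb]
    ring

end LieAlgebra

/-! ### Central extensions from `2`-cocycles -/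

namespace LieAlgebra

section extension

open LieModule.Cohomology

variable {k : Type u} [Field k] {g : Type v} [LieRing g] [LieAlgebra k g]

/-- The ground field as the trivial module of a Lie algebra. -/
local instance trivialLieRingModule : LieRingModule g k where
  bracket _ _ := 0
  add_lie _ _ _ := (add_zero 0).symm
  lie_add _ _ _ := (add_zero 0).symm
  leibniz_lie _ _ _ := (add_zero 0).symm

local instance trivialLieModule : LieModule k g k where
  smul_lie _ _ _ := (smul_zero _).symm
  lie_smul _ _ _ := (smul_zero _).symm

local instance : LieModule.IsTrivial g k := ⟨fun _ _ => rfl⟩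

/-- The `2`-cocycle, in the sense of the cohomology of `g` with trivial coefficients, given by an
alternating bilinear form. -/
def cocycleOfForm (B : Module.Dual k (g ⊗[k] g)) (h0 : ∀ x, B (x ⊗ₜ x) = 0)
    (hB : ∀ x y z : g, B (⁅x, y⁆ ⊗ₜ z) + B (⁅y, z⁆ ⊗ₜ x) + B (⁅z, x⁆ ⊗ₜ y) = 0) :
    twoCocycle k g k :=
  ⟨⟨TensorProduct.curry B, h0⟩, by
    rw [mem_twoCocycle_iff]
    refine LinearMap.ext fun x => LinearMap.ext fun y => LinearMap.ext fun z => ?_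
    rw [d₂₃_apply]
    change 0 - 0 + 0 - B (⁅x, y⁆ ⊗ₜ z) + B (⁅x, z⁆ ⊗ₜ y) - B (⁅y, z⁆ ⊗ₜ x) = 0
    rw [← lie_skew x z, TensorProduct.neg_tmul, map_neg]
    linear_combination -hB x y z⟩

/-- A cocycle `B` on `g` defines a central extension `E` of `g` by `k`. It is given here by its
projection `p` to `g`, a complementary linear coordinate `q`, and the inverse `s` of the linear
isomorphism `(p, q) : E ≅ g × k`. -/
theorem exists_centralExtension (B : Module.Dual k (g ⊗[k] g)) (h0 : ∀ x, B (x ⊗ₜ x) = 0)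
    (hB : ∀ x y z : g, B (⁅x, y⁆ ⊗ₜ z) + B (⁅y, z⁆ ⊗ₜ x) + B (⁅z, x⁆ ⊗ₜ y) = 0) :
    ∃ (E : Type (max u v)) (_ : LieRing E) (_ : LieAlgebra k E) (p : E →ₗ⁅k⁆ g) (q : E →ₗ[k] k)
      (s : g × k →ₗ[k] E), (∀ x c, p (s (x, c)) = x) ∧ (∀ x c, q (s (x, c)) = c) ∧
        (∀ e, s (p e, q e) = e) ∧ ∀ e e', q ⁅e, e'⁆ = B (p e ⊗ₜ p e') := by
  let c := cocycleOfForm B h0 hB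
  refine ⟨ofTwoCocycle c, inferInstance, inferInstance,
    { toFun := fun e => ((ofProd c).symm e).1
      map_add' := fun _ _ => rfl
      map_smul' := fun _ _ => rfl
      map_lie' := rfl },
    { toFun := fun e => ((ofProd c).symm e).2
      map_add' := fun _ _ => rfl
      map_smul' := fun _ _ => rfl },
    { toFun := ofProd c
      map_add' := fun _ _ => rfl
      map_smul' := fun _ _ => rfl },
    fun _ _ => rfl, fun _ _ => rfl, fun _ => rfl, fun e e' => ?_⟩
  change B _ + ⁅((ofProd c).symm e).1, ((ofProd c).symm e').2⁆ -
    ⁅((ofProd c).symm e').1, ((ofProd c).symm e).2⁆ = B _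
  rw [trivial_lie_zero, trivial_lie_zero, add_zero, sub_zero]
  rfl

end extension

end LieAlgebra

/-! ### Maps out of the holonomy Lie algebra -/

namespace CDGA

variable {k : Type u} [Field k]

theorem pairingAlgHom_ofForm [CharZero k] (A : CDGA.{u, v} k) {g : Type w} [LieRing g]
    [LieAlgebra k g] [FiniteDimensional k g] (ω : A.deg 1 ⊗[k] g)
    (B : Module.Dual k (g ⊗[k] g)) :
    pairingAlgHom ω (ExteriorAlgebra.ofForm B) =
      A.mulOne (TensorProduct.map (pairing ω) (pairing ω) (dualTensor B)) := by
  induction B using ExteriorAlgebra.form_induction with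
  | h0 => simp
  | hadd C C' hC hC' => simp only [map_add, Submodule.coe_add, hC, hC']
  | hmul ξ η =>
    rw [ExteriorAlgebra.ofForm_dualDistrib_tmul, dualTensor_dualDistrib, map_mul, pairingAlgHom_ι,
      pairingAlgHom_ι, TensorProduct.map_tmul, coe_mulOne_tmul]

section holonomyLift

variable (A : CDGA.{u, v} k) [A.IsFinite 1] {g : Type w} [LieRing g] [LieAlgebra k g]

/-- The universal property of the holonomy Lie algebra: a linear map `A₁ → g` which satisfies the
holonomy relations extends to `h(A)`. -/
theorem exists_holonomy_lift (ψ : Module.Dual k (A.deg 1) →ₗ[k] g)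
    (hψ : ∀ y : Module.Dual k (A.deg 2), ψ (A.dOne.dualMap y) + (1 / 2 : k) •
      LieAlgebra.bracketMap k g (TensorProduct.map ψ ψ (dualTensor (A.mulOne.dualMap y))) = 0) :
    ∃ Ψ : A.Holonomy →ₗ⁅k⁆ g, ∀ x, Ψ (A.holonomyι x) = ψ x := by
  refine ⟨LieAlgebra.quotLift _ (LieAlgebra.FreeLie.lift ψ) fun x hx => ?_, fun x =>
    LieAlgebra.FreeLie.lift_ι ψ x⟩
  have h : A.holonomyIdeal ≤ (LieAlgebra.FreeLie.lift ψ).ker := by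
    refine LieSubmodule.lieSpan_le.mpr ?_
    rintro _ ⟨y, rfl⟩
    refine LieHom.mem_ker.mpr ((Eq.trans ?_ (hψ y)))
    simp only [holonomyRelation, LinearMap.add_apply, LinearMap.smul_apply, LinearMap.comp_apply,
      map_add, map_smul, LieAlgebra.FreeLie.lift_ι]
    congr 2
    generalize dualTensor (A.mulOne.dualMap y) = t
    induction t with
    | zero => simp
    | add x y hx hy => simp only [map_add, hx, hy]
    | tmul x y => simp [LieAlgebra.FreeLie.lift_ι]
  exact LieHom.mem_ker.mp (h hx)

variable {A} in
theorem holonomy_hom_ext {f f' : A.Holonomy →ₗ⁅k⁆ g}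
    (h : ∀ x, f (A.holonomyι x) = f' (A.holonomyι x)) : f = f' :=
  LieAlgebra.quot_hom_ext fun x => LieHom.congr_fun
    (LieAlgebra.FreeLie.hom_ext (f := f.comp (LieAlgebra.quotMk _))
      (f' := f'.comp (LieAlgebra.quotMk _)) h) x

/-- The map `g* → A¹` given by the image of the canonical connection under `φ : h(A) → g` is the
transpose of the restriction `A₁ → g` of `φ`. -/
theorem apply_pairing_canonicalConnection (φ : A.Holonomy →ₗ⁅k⁆ g) (x : Module.Dual k (A.deg 1))
    (ξ : Module.Dual k g) :
    x (pairing (A.canonicalConnection.map φ).1 ξ) = ξ (φ (A.holonomyι x)) := by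
  classical
  change x (pairing ((φ : A.Holonomy →ₗ[k] g).lTensor (A.deg 1) A.canonicalElement) ξ) = _
  rw [canonicalElement_eq_sum]
  generalize Module.Basis.ofVectorSpace k (A.deg 1) = b
  have hx : ∑ i, x (b i) • b.coord i = x := by
    refine b.ext fun l => ?_
    simp
  refine Eq.trans ?_ (congrArg (fun x => ξ (φ (A.holonomyι x))) hx)
  simp only [map_sum, map_smul, LinearMap.lTensor_tmul, smul_eq_mul]
  refine Eq.trans (b := ∑ i, ξ (φ (A.holonomyι (b.coord i))) * x (b i)) (by simp [pairing])
    (Finset.sum_congr rfl fun _ _ => _root_.mul_comm _ _)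

/-- The transpose relation between `A₁ → g` and `g* → A¹`, for bilinear forms. -/
theorem apply_mulOne_pairing [FiniteDimensional k g] (φ : A.Holonomy →ₗ⁅k⁆ g)
    (B : Module.Dual k (g ⊗[k] g)) (y : Module.Dual k (A.deg 2)) :
    y (A.mulOne (TensorProduct.map (pairing (A.canonicalConnection.map φ).1)
      (pairing (A.canonicalConnection.map φ).1) (dualTensor B))) =
    B (TensorProduct.map ((φ : A.Holonomy →ₗ[k] g) ∘ₗ A.holonomyι)
      ((φ : A.Holonomy →ₗ[k] g) ∘ₗ A.holonomyι) (dualTensor (A.mulOne.dualMap y))) := by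
  rw [← LinearMap.dualMap_apply]
  generalize A.mulOne.dualMap y = C
  induction C using ExteriorAlgebra.form_induction with
  | h0 => simp
  | hadd C C' hC hC' => simp only [LinearMap.add_apply, map_add, hC, hC']
  | hmul x x' =>
    induction B using ExteriorAlgebra.form_induction with
    | h0 => simp
    | hadd C C' hC hC' => simp only [LinearMap.add_apply, map_add, hC, hC']
    | hmul ξ η =>
      simp only [dualTensor_dualDistrib, TensorProduct.map_tmul, TensorProduct.dualDistrib_apply,
        apply_pairing_canonicalConnection]
      rfl

variable [CharZero k]

/-- A `2`-cocycle on a quotient `g` of `h(A)` whose image in `A²` is exact becomes exact on `h(A)`: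
the primitive is the second coordinate of the lift of `h(A) → g` to the central extension of `g` by
the cocycle, and it can be chosen with a prescribed primitive in `A¹`. -/
theorem exists_primitive [FiniteDimensional k g] (φ : A.Holonomy →ₗ⁅k⁆ g)
    {c : ExteriorAlgebra k (Module.Dual k g)} (hc : c ∈ ⋀[k]^2 (Module.Dual k g))
    (hdc : LieAlgebra.cochainDifferential k g c = 0) (a : A.deg 1)
    (ha : pairingAlgHom (A.canonicalConnection.map φ).1 c = A.d a) :
    ∃ ξ : Module.Dual k A.Holonomy, (∀ x, ξ (A.holonomyι x) = x a) ∧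
      ∀ u v, ξ ⁅u, v⁆ = -ExteriorAlgebra.eval₂ (φ u) (φ v) c := by
  obtain ⟨E, _, _, p, q, s, hps, hqs, hs, hq⟩ :=
    LieAlgebra.exists_centralExtension (-ExteriorAlgebra.toForm c)
      (fun x => by
        rw [LinearMap.neg_apply, ExteriorAlgebra.toForm_tmul, ExteriorAlgebra.eval₂_self, neg_zero])
      (fun x y z => by
        have h := LieAlgebra.eval₃_cochainDifferential x y z hc
        rw [hdc, map_zero] at h
        simp only [LinearMap.neg_apply, ExteriorAlgebra.toForm_tmul]
        linear_combination -h)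
  have hE : ∀ e e', p e = p e' → q e = q e' → e = e' := fun e e' h h' => by
    rw [← hs e, ← hs e', h, h']
  -- the lift of `A₁ → g` which has second coordinate the evaluation at `a`
  let ψ : Module.Dual k (A.deg 1) →ₗ[k] E :=
    s ∘ₗ ((φ : A.Holonomy →ₗ[k] g) ∘ₗ A.holonomyι).prod (Module.Dual.eval k _ a)
  have hpψ : ∀ x, p (ψ x) = φ (A.holonomyι x) := fun x => hps _ _
  have hqψ : ∀ x, q (ψ x) = x a := fun x => hqs _ _
  have hda : (2 : k) • A.dOne a = A.mulOne (TensorProduct.map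
      (pairing (A.canonicalConnection.map φ).1) (pairing (A.canonicalConnection.map φ).1)
      (dualTensor (ExteriorAlgebra.toForm c))) := by
    refine Subtype.ext ?_
    rw [← pairingAlgHom_ofForm, ExteriorAlgebra.ofForm_toForm hc, map_smul, ha]
    rfl
  obtain ⟨Ψ, hΨ⟩ := A.exists_holonomy_lift ψ fun y => by
    refine hE _ _ ?_ ?_
    · rw [map_zero, map_add, map_smul, hpψ, ← map_zero φ, ← A.holonomy_relation y, map_add,
        map_smul]
      congr 2
      generalize dualTensor (A.mulOne.dualMap y) = t
      induction t with
      | zero => simp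
      | add x y hx hy => simp only [map_add, hx, hy]
      | tmul x y => simp [hpψ]
    · have hy := congrArg y hda
      rw [apply_mulOne_pairing, map_smul] at hy
      have hbr : ∀ t, q (LieAlgebra.bracketMap k E (TensorProduct.map ψ ψ t)) =
          -ExteriorAlgebra.toForm c (TensorProduct.map ((φ : A.Holonomy →ₗ[k] g) ∘ₗ A.holonomyι)
            ((φ : A.Holonomy →ₗ[k] g) ∘ₗ A.holonomyι) t) := fun t => by
        induction t with
        | zero => simp
        | add x y hx hy => simp only [map_add, hx, hy, neg_add]
        | tmul x y =>
          rw [TensorProduct.map_tmul, LieAlgebra.bracketMap_tmul, hq, hpψ, hpψ]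
          rfl
      rw [map_zero, map_add, map_smul, hqψ, hbr, ← hy, LinearMap.dualMap_apply]
      simp
  have hpΨ : p.comp Ψ = φ := holonomy_hom_ext fun x => by
    rw [LieHom.comp_apply, hΨ, hpψ]
  refine ⟨q ∘ₗ (Ψ : A.Holonomy →ₗ[k] E), fun x => (congrArg q (hΨ x)).trans (hqψ x),
    fun u v => ?_⟩
  change q (Ψ ⁅u, v⁆) = _
  rw [LieHom.map_lie, hq, ← hpΨ]
  rfl

end holonomyLift

/-! ### Cohomology and inductive limits -/

section cohomology

variable {A : CDGA.{u, v₁} k} {B : CDGA.{u, v₂} k}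

theorem Hom.comp_toAlgHom_apply {C : CDGA.{u, v₃} k} (g : Hom B C) (f : Hom A B) (a : A.carrier) :
    (g.comp f).toAlgHom a = g.toAlgHom (f.toAlgHom a) := rfl

theorem Hom.mapCohomology_injective (f : Hom A B) (i : ℕ)
    (h : ∀ a ∈ A.cocycles i, f.toAlgHom a ∈ B.coboundaries i → a ∈ A.coboundaries i) :
    Function.Injective (f.mapCohomology i) := by
  refine (injective_iff_map_eq_zero _).mpr fun x hx => ?_
  obtain ⟨a, rfl⟩ := Submodule.mkQ_surjective _ x
  have hx' : (Submodule.Quotient.mk (f.mapCocycles i a) : B.Cohomology i) = 0 := hx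
  have ha : f.mapCocycles i a ∈ (B.coboundaries i).submoduleOf (B.cocycles i) :=
    (Submodule.Quotient.mk_eq_zero _).mp hx'
  exact (Submodule.Quotient.mk_eq_zero _).mpr (h a a.2 ha)

theorem Hom.mapCohomology_surjective (f : Hom A B) (i : ℕ)
    (h : ∀ b ∈ B.cocycles i, ∃ a ∈ A.cocycles i, f.toAlgHom a = b) :
    Function.Surjective (f.mapCohomology i) := fun y => by
  obtain ⟨b, rfl⟩ := Submodule.mkQ_surjective _ y
  obtain ⟨a, ha, hab⟩ := h b b.2
  exact ⟨Submodule.Quotient.mk ⟨a, ha⟩, congrArg Submodule.Quotient.mk (Subtype.ext hab)⟩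

theorem d_eq_zero_of_mem_deg_zero [A.IsFinite 1] {a : A.carrier} (ha : a ∈ A.deg 0) :
    A.d a = 0 := by
  rw [IsFinite.deg_zero 1] at ha
  obtain ⟨c, rfl⟩ := Submodule.mem_span_singleton.mp ha
  rw [← Algebra.algebraMap_eq_smul_one, d_algebraMap]

end cohomology

namespace Tower

theorem exists_algMap_eq_zero (T : Tower.{u, v} k) {i : ℕ} {x : (T.obj i).carrier}
    (h : T.toLimAlg i x = 0) : ∃ j, ∃ hij : i ≤ j, T.algMap i j hij x = 0 :=
  (DirectLimit.exists_eq_zero (f := T.algMap)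
    (⟨i, x⟩ : Σ i, (T.obj i).carrier)).mp h

end Tower

/-! ### The quotients by the lower central series -/

section lowerCentralSeries

variable {L : Type v} [LieRing L] [LieAlgebra k L]

theorem lie_mem_lcs_succ {n : ℕ} (x : L) {y : L} (hy : y ∈ LieAlgebra.lcs k L n) :
    ⁅x, y⁆ ∈ LieAlgebra.lcs k L (n + 1) := by
  rw [LieAlgebra.lcs, LieModule.lowerCentralSeries_succ]
  exact LieSubmodule.lie_mem_lie (LieSubmodule.mem_top x) hy

/-- The kernel of `L / Γ_{n+2} → L / Γ_{n+1}` is central. -/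
theorem lie_eq_zero_of_lcsProj_eq_zero [LieAlgebra.FinitelyGenerated k L] (n : ℕ)
    (x y : L ⧸ LieAlgebra.lcs k L (n + 1))
    (hy : lcsProj k L n (n + 1) n.le_succ y = 0) : ⁅x, y⁆ = 0 := by
  obtain ⟨x, rfl⟩ := LieAlgebra.quotMk_surjective _ x
  obtain ⟨y, rfl⟩ := LieAlgebra.quotMk_surjective _ y
  rw [← LieHom.map_lie, LieAlgebra.quotMk_eq_zero]
  exact lie_mem_lcs_succ x (LieAlgebra.quotMk_eq_zero.mp hy)

theorem lcsProj_surjective [LieAlgebra.FinitelyGenerated k L] (i j : ℕ) (h : i ≤ j) :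
    Function.Surjective (lcsProj k L i j h) :=
  fun x => by
    obtain ⟨x, rfl⟩ := LieAlgebra.quotMk_surjective _ x
    exact ⟨LieAlgebra.quotMk _ x, rfl⟩

/-- As `L / Γ_{n+2}` is a central extension of `L / Γ_{n+1}`, its bracket is defined on
`L / Γ_{n+1}`, so that the differentials of the linear forms on `L / Γ_{n+2}` come from
`⋀ (L / Γ_{n+1})*`. -/
theorem exists_map_eq_cochainDifferentialGen [LieAlgebra.FinitelyGenerated k L]
    (n : ℕ) (ξ : Module.Dual k (L ⧸ LieAlgebra.lcs k L (n + 1))) :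
    ∃ a, ExteriorAlgebra.map (lcsProj k L n (n + 1) n.le_succ).toLinearMap.dualMap a =
      LieAlgebra.cochainDifferentialGen k _ ξ := by
  -- a linear section `s` of the projection transports the bracket to `L / Γ_{n+1}`
  obtain ⟨s, hs⟩ := (lcsProj k L n (n + 1) n.le_succ).toLinearMap.exists_rightInverse_of_surjective
    (LinearMap.range_eq_top.mpr (lcsProj_surjective n (n + 1) n.le_succ))
  have hs' : ∀ x, lcsProj k L n (n + 1) n.le_succ
      (x - s (lcsProj k L n (n + 1) n.le_succ x)) = 0 := fun x => by
    rw [map_sub, sub_eq_zero]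
    exact (LinearMap.congr_fun hs _).symm
  refine ⟨-((1 / 2 : k) • ExteriorAlgebra.ofForm
    ((TensorProduct.map s s).dualMap ((LieAlgebra.bracketMap k _).dualMap ξ))), ?_⟩
  rw [LieAlgebra.cochainDifferentialGen_eq_ofForm, map_neg, map_smul, ExteriorAlgebra.map_ofForm]
  congr 3
  refine TensorProduct.ext' fun x y => congrArg ξ ?_
  change ⁅s (lcsProj k L n (n + 1) n.le_succ x), s (lcsProj k L n (n + 1) n.le_succ y)⁆ = ⁅x, y⁆
  have h1 := lie_eq_zero_of_lcsProj_eq_zero n x _ (hs' y)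
  have h2 := lie_eq_zero_of_lcsProj_eq_zero n (s (lcsProj k L n (n + 1) n.le_succ y)) _ (hs' x)
  rw [lie_sub, sub_eq_zero] at h1 h2
  rw [h1, ← lie_skew, ← h2, lie_skew]

/-- A linear form on `L` which vanishes on `[L, Γ_{n+1}]` comes from `L / Γ_{n+2}`. -/
theorem exists_dual_quot_lcs (n : ℕ) (ξ : Module.Dual k L)
    (h : ∀ x : L, ∀ y ∈ LieAlgebra.lcs k L n, ξ ⁅x, y⁆ = 0) :
    ∃ ξ' : Module.Dual k (L ⧸ LieAlgebra.lcs k L (n + 1)),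
      ∀ x, ξ' (LieAlgebra.quotMk _ x) = ξ x := by
  refine ⟨Submodule.liftQ (LieAlgebra.lcs k L (n + 1)).toSubmodule ξ fun z hz => ?_, fun x => rfl⟩
  rw [LieAlgebra.lcs, LieModule.lowerCentralSeries_succ,
    LieSubmodule.lieIdeal_oper_eq_linear_span'] at hz
  refine (Submodule.span_le.mpr ?_ : Submodule.span k _ ≤ LinearMap.ker ξ) hz
  rintro _ ⟨x, -, y, hy, rfl⟩
  exact h x y hy

end lowerCentralSeries

/-! ### The algebra `Ĉ(L)` and its `1`-minimality -/

section completedCochains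

variable [CharZero k]

section object

variable (k) (L : Type v) [LieRing L] [LieAlgebra k L] [LieAlgebra.FinitelyGenerated k L]

/-- The canonical map `C(L / Γ_{n+1}) → Ĉ(L)`, as a map of algebras. -/
def ofCochains (n : ℕ) : ExteriorAlgebra k (Module.Dual k (L ⧸ LieAlgebra.lcs k L n)) →ₐ[k]
    (completedCochains k L).carrier :=
  (cochainsTower k L).toLimAlg n

theorem ofCochains_map (i j : ℕ) (h : i ≤ j)
    (a : ExteriorAlgebra k (Module.Dual k (L ⧸ LieAlgebra.lcs k L i))) :
    ofCochains k L j (ExteriorAlgebra.map (lcsProj k L i j h).toLinearMap.dualMap a) =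
      ofCochains k L i a :=
  (cochainsTower k L).toLimAlg_map i j h a

theorem exists_ofCochains (z : (completedCochains k L).carrier) : ∃ n a, z = ofCochains k L n a :=
  (cochainsTower k L).exists_toLimAlg z

theorem exists_ofCochains_of_mem {i : ℕ} {z : (completedCochains k L).carrier}
    (hz : z ∈ (completedCochains k L).deg i) :
    ∃ n, ∃ a ∈ ⋀[k]^i (Module.Dual k (L ⧸ LieAlgebra.lcs k L n)), z = ofCochains k L n a := hz

theorem exists_map_eq_zero_of_ofCochains (i : ℕ)
    (a : ExteriorAlgebra k (Module.Dual k (L ⧸ LieAlgebra.lcs k L i)))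
    (h : ofCochains k L i a = 0) :
    ∃ j, ∃ hij : i ≤ j,
      ExteriorAlgebra.map (lcsProj k L i j hij).toLinearMap.dualMap a = 0 :=
  (cochainsTower k L).exists_algMap_eq_zero h

/-- The map from the dual of `L / Γ_{n+1}` to the degree-one part of `Ĉ(L)`. -/
def completedι (n : ℕ) : Module.Dual k (L ⧸ LieAlgebra.lcs k L n) →ₗ[k]
    (completedCochains k L).carrier :=
  (ofCochains k L n).toLinearMap ∘ₗ ExteriorAlgebra.ι k

theorem completedι_lcsProj (i j : ℕ) (h : i ≤ j) (ξ : Module.Dual k (L ⧸ LieAlgebra.lcs k L i)) :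
    completedι k L j ((lcsProj k L i j h).toLinearMap.dualMap ξ) = completedι k L i ξ := by
  refine Eq.trans ?_ (ofCochains_map k L i j h (ExteriorAlgebra.ι k ξ))
  rw [ExteriorAlgebra.map_apply_ι]
  rfl

theorem d_completedι (n : ℕ) (ξ : Module.Dual k (L ⧸ LieAlgebra.lcs k L n)) :
    (completedCochains k L).d (completedι k L n ξ) =
      ofCochains k L n (LieAlgebra.cochainDifferentialGen k _ ξ) :=
  congrArg (ofCochains k L n) (ExteriorAlgebra.antiderivation_ι
    (LieAlgebra.cochainDifferentialGen k _) (LieAlgebra.cochainDifferentialGen_mem k _) ξ)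

theorem completedι_mem_deg_one (n : ℕ) (ξ : Module.Dual k (L ⧸ LieAlgebra.lcs k L n)) :
    completedι k L n ξ ∈ (completedCochains k L).deg 1 :=
  (cochainsTower k L).toLimAlg_mem (ExteriorAlgebra.ι_mem_one ξ)

theorem exists_completedι {z : (completedCochains k L).carrier}
    (hz : z ∈ (completedCochains k L).deg 1) : ∃ n ξ, z = completedι k L n ξ := by
  obtain ⟨n, y, hy, rfl⟩ := hz
  change y ∈ LinearMap.range (ExteriorAlgebra.ι k) ^ 1 at hy
  rw [pow_one] at hy
  obtain ⟨ξ, rfl⟩ := hy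
  exact ⟨n, ξ, rfl⟩

variable {k L} in
/-- An algebra map out of `Ĉ(L)` is determined by its values on the generators. -/
theorem completedCochains_algHom_ext {R : Type w} [Ring R] [Algebra k R]
    {f f' : (completedCochains k L).carrier →ₐ[k] R}
    (h : ∀ n ξ, f (completedι k L n ξ) = f' (completedι k L n ξ)) : f = f' := by
  refine AlgHom.ext fun z => ?_
  obtain ⟨n, y, rfl⟩ := exists_ofCochains k L z
  have hn : f.comp (ofCochains k L n) = f'.comp (ofCochains k L n) :=
    ExteriorAlgebra.hom_ext (LinearMap.ext (h n))
  exact DFunLike.congr_fun hn y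

/-- The generators of `Ĉ(L)` which come from `L / Γ_{n+1}`. -/
def generators (n : ℕ) : Submodule k (completedCochains k L).carrier :=
  LinearMap.range (completedι k L n)

theorem generators_mono : Monotone (generators k L) := by
  rintro i j h _ ⟨ξ, rfl⟩
  exact ⟨_, completedι_lcsProj k L i j h ξ⟩

theorem iSup_generators_le : ⨆ n, generators k L n ≤ (completedCochains k L).deg 1 :=
  iSup_le fun n => by
    rintro _ ⟨ξ, rfl⟩
    exact completedι_mem_deg_one k L n ξ

/-- The map from the dual of `L / Γ_{n+1}` to the space of all generators of `Ĉ(L)`. -/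
def toGenerators (n : ℕ) : Module.Dual k (L ⧸ LieAlgebra.lcs k L n) →ₗ[k]
    (⨆ n, generators k L n : Submodule k (completedCochains k L).carrier) :=
  (completedι k L n).codRestrict _ fun ξ => Submodule.mem_iSup_of_mem n ⟨ξ, rfl⟩

/-- The canonical map `⋀ V → Ĉ(L)`, for the space `V` of generators. -/
def ofExteriorGenerators : ExteriorAlgebra k
    (⨆ n, generators k L n : Submodule k (completedCochains k L).carrier) →ₐ[k]
      (completedCochains k L).carrier :=
  ExteriorAlgebra.lift k ⟨Submodule.subtype _, fun x =>
    sq_zero_of_mem_deg_one (iSup_generators_le k L x.2)⟩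

theorem ofExteriorGenerators_ι
    (x : (⨆ n, generators k L n : Submodule k (completedCochains k L).carrier)) :
    ofExteriorGenerators k L (ExteriorAlgebra.ι k x) = x :=
  ExteriorAlgebra.lift_ι_apply _ _ _ _

/-- The map `Ĉ(L) → ⋀ V`, for the space `V` of generators, induced by the maps from the duals of
the quotients `L / Γ_{n+1}` to `V`. -/
def toExteriorGenerators : (completedCochains k L).carrier →ₐ[k] ExteriorAlgebra k
    (⨆ n, generators k L n : Submodule k (completedCochains k L).carrier) :=
  (cochainsTower k L).limLiftAlg (fun n => ExteriorAlgebra.map (toGenerators k L n))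
    fun i j h x => by
      have hc : toGenerators k L j ∘ₗ (lcsProj k L i j h).toLinearMap.dualMap =
          toGenerators k L i :=
        LinearMap.ext fun ξ => Subtype.ext (completedι_lcsProj k L i j h ξ)
      have hm := ExteriorAlgebra.map_comp_map (lcsProj k L i j h).toLinearMap.dualMap
        (toGenerators k L j)
      rw [hc] at hm
      exact DFunLike.congr_fun hm x

theorem toExteriorGenerators_completedι (n : ℕ) (ξ : Module.Dual k (L ⧸ LieAlgebra.lcs k L n)) :
    toExteriorGenerators k L (completedι k L n ξ) =
      ExteriorAlgebra.ι k (toGenerators k L n ξ) :=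
  ExteriorAlgebra.map_apply_ι (toGenerators k L n) ξ

theorem isFreeOn_generators : (completedCochains k L).IsFreeOn (⨆ n, generators k L n) := by
  refine ⟨iSup_generators_le k L, AlgEquiv.ofAlgHom (ofExteriorGenerators k L)
    (toExteriorGenerators k L) ?_ ?_, ofExteriorGenerators_ι k L⟩
  · refine completedCochains_algHom_ext fun n ξ => ?_
    rw [AlgHom.comp_apply, toExteriorGenerators_completedι, ofExteriorGenerators_ι]
    rfl
  · refine ExteriorAlgebra.hom_ext (LinearMap.ext fun ⟨x, hx⟩ => ?_)
    obtain ⟨n, ξ, rfl⟩ := (Submodule.mem_iSup_of_directed _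
      (generators_mono k L).directed_le).mp hx
    change toExteriorGenerators k L (ofExteriorGenerators k L (ExteriorAlgebra.ι k _)) =
      ExteriorAlgebra.ι k _
    rw [ofExteriorGenerators_ι, toExteriorGenerators_completedι]
    rfl

/-- The algebra maps from `⋀ (L / Γ_{n+1})*` land in the subalgebra generated by `generators n`. -/
theorem ofCochains_mem_adjoin (n : ℕ)
    (a : ExteriorAlgebra k (Module.Dual k (L ⧸ LieAlgebra.lcs k L n))) :
    ofCochains k L n a ∈
      Algebra.adjoin k (generators k L n : Set (completedCochains k L).carrier) := by
  induction a using ExteriorAlgebra.induction with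
  | algebraMap r =>
    rw [AlgHom.commutes]
    exact Subalgebra.algebraMap_mem _ r
  | ι ξ => exact Algebra.subset_adjoin ⟨ξ, rfl⟩
  | mul a b ha hb => rw [map_mul]; exact mul_mem ha hb
  | add a b ha hb => rw [map_add]; exact add_mem ha hb

theorem isOneMinimal_completedCochains : (completedCochains k L).IsOneMinimal := by
  refine ⟨generators k L, ?_, generators_mono k L, isFreeOn_generators k L, ?_⟩
  · -- `lcs k L 0` is all of `L`, so that the filtration starts with the dual of a zero space
    rw [eq_bot_iff]
    rintro _ ⟨ξ, rfl⟩
    have h : ξ = 0 := LinearMap.ext fun x => by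
      obtain ⟨x, rfl⟩ := LieAlgebra.quotMk_surjective _ x
      rw [LieAlgebra.quotMk_eq_zero.mpr (by simp), map_zero, map_zero]
    rw [h, map_zero]
    exact Submodule.zero_mem _
  · rintro n _ ⟨ξ, rfl⟩
    obtain ⟨a, ha⟩ := exists_map_eq_cochainDifferentialGen n ξ
    rw [d_completedι, ← ha, ofCochains_map]
    exact ofCochains_mem_adjoin k L n a

/-- If the generator given by a linear form `ξ` is closed in `Ĉ(L)`, then `ξ` vanishes on the
brackets. -/
theorem apply_lie_eq_zero_of_d_completedι (n : ℕ)
    (ξ : Module.Dual k (L ⧸ LieAlgebra.lcs k L n))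
    (h : (completedCochains k L).d (completedι k L n ξ) = 0)
    (x y : L ⧸ LieAlgebra.lcs k L n) : ξ ⁅x, y⁆ = 0 := by
  rw [d_completedι] at h
  obtain ⟨j, hj, h⟩ := exists_map_eq_zero_of_ofCochains k L n _ h
  rw [map_cochainDifferentialGen] at h
  obtain ⟨x, rfl⟩ := lcsProj_surjective n j hj x
  obtain ⟨y, rfl⟩ := lcsProj_surjective n j hj y
  have h' := congrArg (ExteriorAlgebra.eval₂ x y) h
  rw [LieAlgebra.eval₂_cochainDifferentialGen, map_zero, neg_eq_zero] at h'
  rw [← LieHom.map_lie]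
  exact h'

end object

end completedCochains

/-! ### Functoriality and naturality -/

theorem dualMap_lcsMap_quotMk {L : Type v} [LieRing L] [LieAlgebra k L] {L' : Type w}
    [LieRing L'] [LieAlgebra k L'] (φ : L →ₗ⁅k⁆ L') (n : ℕ)
    (ξ : Module.Dual k (L' ⧸ LieAlgebra.lcs k L' n)) (x : L) :
    (lcsMap φ n).toLinearMap.dualMap ξ (LieAlgebra.quotMk _ x) = ξ (LieAlgebra.quotMk _ (φ x)) :=
  rfl

section completedCochains

variable [CharZero k]

section morphism

variable {L : Type v} [LieRing L] [LieAlgebra k L] [LieAlgebra.FinitelyGenerated k L]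
variable {L' : Type w} [LieRing L'] [LieAlgebra k L'] [LieAlgebra.FinitelyGenerated k L']
variable {L'' : Type v₁} [LieRing L''] [LieAlgebra k L''] [LieAlgebra.FinitelyGenerated k L'']

theorem completedCochainsMap_completedι (φ : L →ₗ⁅k⁆ L') (n : ℕ)
    (ξ : Module.Dual k (L' ⧸ LieAlgebra.lcs k L' n)) :
    (completedCochainsMap φ).toAlgHom (completedι k L' n ξ) =
      completedι k L n ((lcsMap φ n).toLinearMap.dualMap ξ) :=
  congrArg ((cochainsTower k L).toLimAlg n) (ExteriorAlgebra.map_apply_ι _ ξ)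

theorem completedCochainsMap_id :
    completedCochainsMap (LieHom.id : L →ₗ⁅k⁆ L) = Hom.id (completedCochains k L) := by
  refine Hom.ext (completedCochains_algHom_ext fun n ξ => ?_)
  refine (completedCochainsMap_completedι _ n ξ).trans (congrArg (completedι k L n) ?_)
  refine LinearMap.ext fun x => ?_
  obtain ⟨x, rfl⟩ := LieAlgebra.quotMk_surjective _ x
  rfl

theorem completedCochainsMap_comp (ψ : L' →ₗ⁅k⁆ L'') (φ : L →ₗ⁅k⁆ L') :
    completedCochainsMap (ψ.comp φ) =
      (completedCochainsMap φ).comp (completedCochainsMap ψ) := by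
  refine Hom.ext (completedCochains_algHom_ext fun n ξ => ?_)
  rw [Hom.comp_toAlgHom_apply, completedCochainsMap_completedι, completedCochainsMap_completedι,
    completedCochainsMap_completedι]
  refine congrArg (completedι k L n) (LinearMap.ext fun x => ?_)
  obtain ⟨x, rfl⟩ := LieAlgebra.quotMk_surjective _ x
  rfl

end morphism

end completedCochains

section holonomyFunctor

theorem eq_of_forall_dual_apply_eq {A : CDGA.{u, v} k} {a b : A.deg 1}
    (h : ∀ x : Module.Dual k (A.deg 1), x a = x b) : a = b := by
  rw [← sub_eq_zero, ← Module.forall_dual_apply_eq_zero_iff k]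
  exact fun x => by rw [map_sub, h, sub_self]

variable {A : CDGA.{u, v₁} k} {B : CDGA.{u, v₂} k} {C : CDGA.{u, v₃} k}
variable [A.IsFinite 1] [B.IsFinite 1] [C.IsFinite 1]

theorem holonomyMap_holonomyι (φ : Hom A B) (x : Module.Dual k (B.deg 1)) :
    holonomyMap φ (B.holonomyι x) = A.holonomyι ((φ.degMap 1).dualMap x) :=
  congrArg (LieAlgebra.quotMk A.holonomyIdeal) (LieAlgebra.FreeLie.lift_ι _ x)

theorem holonomyMap_id : holonomyMap (Hom.id A) = LieHom.id :=
  holonomy_hom_ext fun x => holonomyMap_holonomyι _ x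

theorem holonomyMap_comp (ψ : Hom B C) (φ : Hom A B) :
    holonomyMap (ψ.comp φ) = (holonomyMap φ).comp (holonomyMap ψ) :=
  holonomy_hom_ext fun x => by
    rw [LieHom.comp_apply, holonomyMap_holonomyι, holonomyMap_holonomyι, holonomyMap_holonomyι]
    rfl

variable [CharZero k]

theorem classifyingMap_ofCochains (n : ℕ)
    (a : ExteriorAlgebra k (Module.Dual k (A.Holonomy ⧸ LieAlgebra.lcs k A.Holonomy n))) :
    A.classifyingMap.toAlgHom (ofCochains k A.Holonomy n a) =
      pairingAlgHom (A.canonicalConnection.map (LieAlgebra.quotMk _)).1 a := rfl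

theorem classifyingMap_completedι (n : ℕ)
    (ξ : Module.Dual k (A.Holonomy ⧸ LieAlgebra.lcs k A.Holonomy n)) :
    A.classifyingMap.toAlgHom (completedι k A.Holonomy n ξ) =
      pairing (A.canonicalConnection.map (LieAlgebra.quotMk _)).1 ξ :=
  (classifyingMap_ofCochains n _).trans (pairingAlgHom_ι _ ξ)

theorem classifyingMap_natural (φ : Hom A B) :
    φ.comp A.classifyingMap =
      B.classifyingMap.comp (completedCochainsMap (holonomyMap φ)) := by
  refine Hom.ext (completedCochains_algHom_ext fun n ξ => ?_)
  rw [Hom.comp_toAlgHom_apply, Hom.comp_toAlgHom_apply, completedCochainsMap_completedι,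
    classifyingMap_completedι, classifyingMap_completedι]
  have hp : φ.degMap 1 (pairing (A.canonicalConnection.map (LieAlgebra.quotMk _)).1 ξ) =
      pairing (B.canonicalConnection.map (LieAlgebra.quotMk _)).1
        ((lcsMap (holonomyMap φ) n).toLinearMap.dualMap ξ) := by
    refine eq_of_forall_dual_apply_eq fun x => ?_
    have h1 := A.apply_pairing_canonicalConnection
      (LieAlgebra.quotMk (LieAlgebra.lcs k A.Holonomy n)) ((φ.degMap 1).dualMap x) ξ
    have h2 := B.apply_pairing_canonicalConnection
      (LieAlgebra.quotMk (LieAlgebra.lcs k B.Holonomy n)) x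
      ((lcsMap (holonomyMap φ) n).toLinearMap.dualMap ξ)
    rw [LinearMap.dualMap_apply] at h1
    refine h1.trans (Eq.trans ?_ h2.symm)
    rw [← holonomyMap_holonomyι]
    exact (dualMap_lcsMap_quotMk (holonomyMap φ) n ξ (B.holonomyι x)).symm
  exact congrArg Subtype.val hp

end holonomyFunctor

/-! ### A criterion for `1`-equivalences out of `Ĉ(L)` -/

section equivalenceCriterion

variable [CharZero k] {L : Type v} [LieRing L] [LieAlgebra k L] [LieAlgebra.FinitelyGenerated k L]
variable {A : CDGA.{u, w} k}

/-- The following property of a cdga map `f : Ĉ(L) → A`: if the image in `A²` of a `2`-cocycle `c`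
on some `L / Γ_{n+1}` is the differential of `a ∈ A¹`, then the pullback of `c` to `L` is the
differential of a linear form `ξ`, and `f` maps the generators which `ξ` defines to `a`. -/
def Hom.HasPrimitives (f : Hom (completedCochains k L) A) : Prop :=
  ∀ (n : ℕ) {c : ExteriorAlgebra k (Module.Dual k (L ⧸ LieAlgebra.lcs k L n))},
    c ∈ ⋀[k]^2 (Module.Dual k (L ⧸ LieAlgebra.lcs k L n)) →
    LieAlgebra.cochainDifferential k _ c = 0 → ∀ a : A.deg 1,
    f.toAlgHom (ofCochains k L n c) = A.d a →
    ∃ ξ : Module.Dual k L,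
      (∀ (m : ℕ) (ξ' : Module.Dual k (L ⧸ LieAlgebra.lcs k L m)),
        (∀ x, ξ' (LieAlgebra.quotMk _ x) = ξ x) → f.toAlgHom (completedι k L m ξ') = a) ∧
      ∀ u v, ξ ⁅u, v⁆ =
        -ExteriorAlgebra.eval₂ (LieAlgebra.quotMk _ u) (LieAlgebra.quotMk _ v) c

variable (f : Hom (completedCochains k L) A)

/-- A closed element of degree two of `Ĉ(L)` is a cocycle on some quotient `L / Γ_{n+1}`. If its
image in `A²` is exact, then its pullback to the next quotient `L / Γ_{n+2}` is exact. -/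
theorem injective_mapCohomology_two (hprim : f.HasPrimitives) :
    Function.Injective (f.mapCohomology 2) := by
  refine f.mapCohomology_injective 2 fun z hz h => ?_
  obtain ⟨i, c₀, hc₀, rfl⟩ := exists_ofCochains_of_mem k L hz.1
  -- `c₀` becomes closed at a finite stage of the tower
  obtain ⟨n, hn, hd⟩ := exists_map_eq_zero_of_ofCochains k L i
    (LieAlgebra.cochainDifferential k _ c₀) hz.2
  obtain ⟨c, hc⟩ : ∃ c, c = ExteriorAlgebra.map
    (lcsProj k L i n hn).toLinearMap.dualMap c₀ := ⟨_, rfl⟩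
  have hc2 : c ∈ ⋀[k]^2 (Module.Dual k (L ⧸ LieAlgebra.lcs k L n)) := by
    rw [hc]
    exact (cochainsMap (lcsProj k L i n hn)).map_deg hc₀
  have hdc : LieAlgebra.cochainDifferential k _ c = 0 := by
    rw [hc]
    exact ((cochainsMap (lcsProj k L i n hn)).map_d c₀).symm.trans hd
  rw [← ofCochains_map k L i n hn, ← hc] at h ⊢
  obtain ⟨a, ha, hac⟩ := h
  obtain ⟨ξ, -, hξ⟩ := hprim n hc2 hdc ⟨a, ha⟩ hac.symm
  obtain ⟨ξ', hξ'⟩ := exists_dual_quot_lcs n ξ fun x y hy => by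
    rw [hξ, LieAlgebra.quotMk_eq_zero.mpr hy, ← ExteriorAlgebra.toForm_tmul,
      TensorProduct.tmul_zero, map_zero, neg_zero]
  have hform : (LieAlgebra.bracketMap k _).dualMap ξ' =
      -(TensorProduct.map (lcsProj k L n (n + 1) n.le_succ).toLinearMap
        (lcsProj k L n (n + 1) n.le_succ).toLinearMap).dualMap
          (ExteriorAlgebra.toForm c) := by
    refine TensorProduct.ext' fun x y => ?_
    obtain ⟨x, rfl⟩ := LieAlgebra.quotMk_surjective _ x
    obtain ⟨y, rfl⟩ := LieAlgebra.quotMk_surjective _ y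
    rw [LinearMap.dualMap_apply, LieAlgebra.bracketMap_tmul, ← LieHom.map_lie, hξ', hξ]
    rfl
  have hgen : LieAlgebra.cochainDifferentialGen k _ ξ' = ExteriorAlgebra.map
      (lcsProj k L n (n + 1) n.le_succ).toLinearMap.dualMap c := by
    rw [LieAlgebra.cochainDifferentialGen_eq_ofForm, hform, map_neg, smul_neg, neg_neg,
      ← ExteriorAlgebra.map_ofForm, ExteriorAlgebra.ofForm_toForm hc2, map_smul, smul_smul,
      one_div_mul_cancel two_ne_zero, one_smul]
  refine ⟨completedι k L (n + 1) ξ', completedι_mem_deg_one _ _ _ _, ?_⟩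
  rw [d_completedι, hgen, ofCochains_map]

variable [A.IsFinite 1]

theorem bijective_mapCohomology_zero : Function.Bijective (f.mapCohomology 0) := by
  refine ⟨f.mapCohomology_injective 0 fun a ha h => ?_,
    f.mapCohomology_surjective 0 fun b hb => ?_⟩
  · obtain ⟨n, y, hy, rfl⟩ := exists_ofCochains_of_mem k L ha.1
    change y ∈ LinearMap.range (ExteriorAlgebra.ι k) ^ 0 at hy
    rw [pow_zero, Submodule.mem_one] at hy
    obtain ⟨r, rfl⟩ := hy
    have : Nontrivial A.carrier := ⟨1, 0, IsFinite.one_ne_zero 1⟩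
    have h' : f.toAlgHom
        (ofCochains k L n (algebraMap k _ r)) = 0 := h
    rw [AlgHom.commutes, AlgHom.commutes,
      map_eq_zero_iff _ (algebraMap k A.carrier).injective] at h'
    rw [h', map_zero, map_zero]
    exact Submodule.zero_mem _
  · have hb0 := hb.1
    rw [IsFinite.deg_zero 1] at hb0
    obtain ⟨c, rfl⟩ := Submodule.mem_span_singleton.mp hb0
    refine ⟨c • 1, ⟨Submodule.smul_mem _ c SetLike.GradedOne.one_mem, ?_⟩, by
      rw [map_smul, map_one]⟩
    rw [← Algebra.algebraMap_eq_smul_one]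
    exact d_algebraMap _ c

/-- The closed generators are the linear forms which vanish on the brackets. The hypothesis `hinj`
says that `f` is injective on these. -/
theorem bijective_mapCohomology_one
    (hinj : ∀ n (ξ : Module.Dual k (L ⧸ LieAlgebra.lcs k L n)),
      (∀ x y : L ⧸ LieAlgebra.lcs k L n, ξ ⁅x, y⁆ = 0) →
        f.toAlgHom (completedι k L n ξ) = 0 → ξ = 0)
    (hprim : f.HasPrimitives) : Function.Bijective (f.mapCohomology 1) := by
  refine ⟨f.mapCohomology_injective 1 fun z hz h => ?_,
    f.mapCohomology_surjective 1 fun b hb => ?_⟩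
  · obtain ⟨n, ξ, rfl⟩ := exists_completedι k L hz.1
    obtain ⟨c, hc, hcz⟩ := h
    rw [d_eq_zero_of_mem_deg_zero hc] at hcz
    rw [hinj n ξ (apply_lie_eq_zero_of_d_completedι k L n ξ hz.2) hcz.symm, map_zero]
    exact Submodule.zero_mem _
  · -- a closed element of `A¹` is a primitive of the image of the cocycle `0`
    obtain ⟨ξ, hξ, hbr⟩ := hprim 0 (Submodule.zero_mem _) (map_zero _) ⟨b, hb.1⟩
      (by rw [map_zero, map_zero]; exact hb.2.symm)
    simp only [map_zero, neg_zero] at hbr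
    obtain ⟨ξ', hξ'⟩ := exists_dual_quot_lcs 0 ξ fun x y _ => hbr x y
    refine ⟨completedι k L 1 ξ', ⟨completedι_mem_deg_one k L 1 ξ', ?_⟩, ?_⟩
    · have h0 : (LieAlgebra.bracketMap k _).dualMap ξ' = 0 := TensorProduct.ext' fun x y => by
        obtain ⟨x, rfl⟩ := LieAlgebra.quotMk_surjective _ x
        obtain ⟨y, rfl⟩ := LieAlgebra.quotMk_surjective _ y
        rw [LinearMap.dualMap_apply, LieAlgebra.bracketMap_tmul, ← LieHom.map_lie, hξ', hbr]
        rfl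
      rw [SetLike.mem_coe, LinearMap.mem_ker, d_completedι,
        LieAlgebra.cochainDifferentialGen_eq_ofForm, h0, map_zero, smul_zero, neg_zero, map_zero]
    · exact hξ 1 ξ' hξ'

end equivalenceCriterion

/-! ### The classifying map is a `1`-minimal model map -/

section equivalence

variable (A : CDGA.{u, v} k) [A.IsFinite 1]

attribute [local instance] LieRing.ofAssociativeRing in
/-- A linear form on `h(A)` which vanishes on the brackets is determined by its values on `A₁`. -/
theorem eq_zero_of_comp_holonomyι_eq_zero {ξ : Module.Dual k A.Holonomy}
    (hbr : ∀ x y : A.Holonomy, ξ ⁅x, y⁆ = 0) (hξ : ∀ x, ξ (A.holonomyι x) = 0) : ξ = 0 := by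
  -- `ξ` is a map of Lie algebras to the abelian Lie algebra `k`
  let Ξ : A.Holonomy →ₗ⁅k⁆ k :=
    { ξ with
      map_lie' := fun {x y} => by
        refine (hbr x y).trans ?_
        rw [LieRing.of_associative_ring_bracket, _root_.mul_comm, sub_self] }
  have hΞ : Ξ = 0 := holonomy_hom_ext hξ
  exact LinearMap.ext fun x => LieHom.congr_fun hΞ x

variable [CharZero k]

theorem isOneMinimalModelMap_classifyingMap : A.classifyingMap.IsOneMinimalModelMap := by
  have hinj : ∀ n (ξ : Module.Dual k (A.Holonomy ⧸ LieAlgebra.lcs k A.Holonomy n)),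
      (∀ x y : A.Holonomy ⧸ LieAlgebra.lcs k A.Holonomy n, ξ ⁅x, y⁆ = 0) →
      A.classifyingMap.toAlgHom (completedι k A.Holonomy n ξ) = 0 → ξ = 0 := fun n ξ hbr h => by
    rw [classifyingMap_completedι] at h
    have hp : pairing (A.canonicalConnection.map (LieAlgebra.quotMk
        (LieAlgebra.lcs k A.Holonomy n))).1 ξ = 0 := Subtype.ext h
    have h0 : ξ ∘ₗ (LieAlgebra.quotMk (LieAlgebra.lcs k A.Holonomy n)).toLinearMap = 0 := by
      refine A.eq_zero_of_comp_holonomyι_eq_zero (fun x y => ?_) fun x => ?_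
      · exact (congrArg ξ (LieHom.map_lie (LieAlgebra.quotMk _) x y)).trans (hbr _ _)
      · refine (A.apply_pairing_canonicalConnection _ x ξ).symm.trans ?_
        rw [hp, map_zero]
    refine LinearMap.ext fun x => ?_
    obtain ⟨x, rfl⟩ := LieAlgebra.quotMk_surjective _ x
    exact LinearMap.congr_fun h0 x
  have hprim : A.classifyingMap.HasPrimitives := fun n c hc hdc a ha => by
    rw [classifyingMap_ofCochains] at ha
    obtain ⟨ξ, hξ, hbr⟩ := A.exists_primitive _ hc hdc a ha
    refine ⟨ξ, fun m ξ' h => ?_, hbr⟩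
    rw [classifyingMap_completedι]
    refine congrArg Subtype.val (eq_of_forall_dual_apply_eq fun x => ?_)
    rw [apply_pairing_canonicalConnection, h, hξ]
  refine ⟨isOneMinimal_completedCochains k A.Holonomy, fun i hi => ?_,
    injective_mapCohomology_two _ hprim⟩
  interval_cases i
  · exact bijective_mapCohomology_zero _
  · exact bijective_mapCohomology_one _ hinj hprim

end equivalence

end CDGA
end

theorem theorem1p3 {k : Type u} [Field k] [CharZero k] :
    -- the classifying map `f_A : Ĉ(h(A)) → A` is a `1`-minimal model map for `A`
    (∀ (A : CDGA.{u, v} k) [A.IsFinite 1], A.classifyingMap.IsOneMinimalModelMap) ∧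
    -- `A ↦ Ĉ(h(A))` is a functor
    (∀ (A : CDGA.{u, v} k) [A.IsFinite 1],
      CDGA.completedCochainsMap (CDGA.holonomyMap (CDGA.Hom.id A)) =
        CDGA.Hom.id (CDGA.completedCochains k A.Holonomy)) ∧
    (∀ (A : CDGA.{u, v₁} k) (B : CDGA.{u, v₂} k) (C : CDGA.{u, v₃} k)
      [A.IsFinite 1] [B.IsFinite 1] [C.IsFinite 1] (φ : CDGA.Hom A B) (ψ : CDGA.Hom B C),
      CDGA.completedCochainsMap (CDGA.holonomyMap (ψ.comp φ)) =
        (CDGA.completedCochainsMap (CDGA.holonomyMap ψ)).comp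
          (CDGA.completedCochainsMap (CDGA.holonomyMap φ))) ∧
    -- `f_A` is natural in `A`
    (∀ (A : CDGA.{u, v₁} k) (B : CDGA.{u, v₂} k) [A.IsFinite 1] [B.IsFinite 1]
      (φ : CDGA.Hom A B),
      φ.comp A.classifyingMap =
        B.classifyingMap.comp (CDGA.completedCochainsMap (CDGA.holonomyMap φ))) := by
  exact ⟨fun A _ => A.isOneMinimalModelMap_classifyingMap,
    fun A _ => by rw [CDGA.holonomyMap_id, CDGA.completedCochainsMap_id],
    fun A B C _ _ _ φ ψ => by rw [CDGA.holonomyMap_comp, CDGA.completedCochainsMap_comp],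
    fun A B _ _ φ => CDGA.classifyingMap_natural φ⟩
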